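/- Let $m=(m_k)_{k\ge 0}$ be a bounded sequence of integers $m_k\ge 2$, let $G_m=\prod_{k\ge 0}\mathbb Z/m_k\mathbb Z$ be the corresponding (bounded) Vilenkin group with its normalized Haar measure, and let $\mu$ be the normalized Haar (product) measure on $G_m^2=G_m\times G_m$. Put $M_0=1$, $M_{k+1}=m_kM_k$, and $I_n=\{x\in G_m: x_0=\dots=x_{n-1}=0\}$. Writing $n=\sum_k n_kM_k$ with $0\le n_k<m_k$, let $\psi_n(x)=\prod_k \exp(2\pi i\,n_kx_k/m_k)$ be the Vilenkin functions. For $1\le p<\infty$ let $L^p=L^p(G_m^2)$ be the usual space of complex-valued functions with norm $\|\cdot\|_p$, and let $L^\infty$ denote the space $C(G_m^2)$ of continuous functions with the supremum norm. For $f\in L^p$ let $$\hat f(i,j)=\int_{G_m^2} f(x,y)\,\overline{\psi_i(x)}\,\overline{\psi_j(y)}\,d\mu(x,y),\qquad A_0^{a}=1,\quad A_n^{a}=\frac{(a+1)\cdots(a+n)}{n!},$$ $$\sigma_{n,l}^{-\alpha,-\beta}f(x,y)=\frac{1}{A_n^{-\alpha}A_l^{-\beta}}\sum_{i=0}^{n}\sum_{j=0}^{l}A_{n-i}^{-\alpha}A_{l-j}^{-\beta}\,\hat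 f(i,j)\,\psi_i(x)\psi_j(y),$$ $$\omega\Bigl(f,\frac1{M_n}\Bigr)_p=\sup_{(u,v)\in I_n\times I_n}\bigl\|f(\cdot-u,\cdot-v)-f(\cdot,\cdot)\bigr\|_p .$$ Let $f\in L^p$ for some $p\in[1,\infty]$, and let $\alpha,\beta\in(0,1)$ with $\alpha+\beta<1$. If $$\omega\Bigl(f,\frac1{M_n}\Bigr)_p=o\Bigl(\Bigl(\frac1{M_n}\Bigr)^{\alpha+\beta}\Bigr)\qquad(n\to\infty),$$ then $$\bigl\|\sigma_{n,l}^{-\alpha,-\beta}f-f\bigr\|_p\to 0\qquad\text{as } n,l\to\infty,$$ where $n$ and $l$ tend to infinity independently of each other. -/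

import Mathlib

open MeasureTheory Filter Topology
open scoped ENNReal

noncomputable section

namespace Vilenkin

/-- The Vilenkin group `G_m`: the complete direct product of the cyclic groups `ℤ / m_k`, with
coordinatewise addition, the product of the discrete topologies and the product σ-algebra. -/
abbrev VGroup (m : ℕ → ℕ) : Type := ∀ k : ℕ, ZMod (m k)

/-- The generalized powers: `M_0 = 1`, `M_{k+1} = m_k M_k`. -/
def M (m : ℕ → ℕ) : ℕ → ℕ
  | 0 => 1
  | k + 1 => m k * M m k

/-- The subgroup `I_n = {x : x_0 = ⋯ = x_{n-1} = 0}`, as a set. -/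
def I (m : ℕ → ℕ) (n : ℕ) : Set (VGroup m) := {x | ∀ k < n, x k = 0}

/-- The measure on `ℤ / m_k` giving mass `1 / m_k` to each point. -/
def coordMeasure (m : ℕ → ℕ) (k : ℕ) : Measure (ZMod (m k)) := (m k : ℝ≥0∞)⁻¹ • Measure.count

instance coordMeasure_isProbabilityMeasure (m : ℕ → ℕ) [∀ k, NeZero (m k)] (k : ℕ) :
    IsProbabilityMeasure (coordMeasure m k) := by
  constructor
  have h : Measure.count (Set.univ : Set (ZMod (m k))) = (m k : ℝ≥0∞) := by
    rw [Measure.count_apply_finite _ Set.finite_univ]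
    simp [ZMod.card]
  rw [coordMeasure, Measure.smul_apply, h, smul_eq_mul]
  exact ENNReal.inv_mul_cancel (by exact_mod_cast NeZero.ne (m k)) (ENNReal.natCast_ne_top _)

/-- The normalized Haar measure of `G_m`: the product of the measures `coordMeasure m k`. -/
def haar (m : ℕ → ℕ) [∀ k, NeZero (m k)] : Measure (VGroup m) :=
  Measure.infinitePi (coordMeasure m)

/-- The normalized Haar measure of `G_m × G_m`. -/
def haar2 (m : ℕ → ℕ) [∀ k, NeZero (m k)] : Measure (VGroup m × VGroup m) :=
  (haar m).prod (haar m)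

/-- The generalized Rademacher functions `r_k(x) = exp (2 π i x_k / m_k)`, where `x_k` is
represented in `{0, …, m_k - 1}`. -/
def rademacher (m : ℕ → ℕ) (k : ℕ) (x : VGroup m) : ℂ :=
  Complex.exp (2 * Real.pi * Complex.I * ((x k).val : ℂ) / (m k : ℂ))

/-- The digit `n_k` of `n = ∑ n_k M_k`, `0 ≤ n_k < m_k`. -/
def digit (m : ℕ → ℕ) (n k : ℕ) : ℕ := n / M m k % m k

/-- The Vilenkin functions `ψ_n = ∏_k r_k ^ n_k`. When all `m_k ≥ 2` one has `n < M_n`, so that the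
digits `n_k` with `k ≥ n` vanish and the product may stop there. -/
def psi (m : ℕ → ℕ) (n : ℕ) (x : VGroup m) : ℂ :=
  ∏ k ∈ Finset.range n, rademacher m k x ^ digit m n k

/-- The Fourier coefficients with respect to the double Vilenkin system. -/
def doubleCoeff (m : ℕ → ℕ) [∀ k, NeZero (m k)] (f : VGroup m × VGroup m → ℂ) (i j : ℕ) : ℂ :=
  ∫ z, f z * (starRingEnd ℂ) (psi m i z.1) * (starRingEnd ℂ) (psi m j z.2) ∂(haar2 m)

/-- The Cesàro numbers `A_n^a = (a + 1) ⋯ (a + n) / n!`. -/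
def cesaroNumber (a : ℝ) (n : ℕ) : ℝ :=
  (∏ k ∈ Finset.range n, (a + ((k : ℝ) + 1))) / (n.factorial : ℝ)

/-- The Cesàro `(C, a, b)` means `σ_{n,l}^{a,b} f` of the double Vilenkin-Fourier series. -/
def cesaroMean (m : ℕ → ℕ) [∀ k, NeZero (m k)] (a b : ℝ) (n l : ℕ)
    (f : VGroup m × VGroup m → ℂ) (z : VGroup m × VGroup m) : ℂ :=
  1 / ((cesaroNumber a n : ℂ) * (cesaroNumber b l : ℂ)) *
    ∑ i ∈ Finset.range (n + 1), ∑ j ∈ Finset.range (l + 1),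
      (cesaroNumber a (n - i) : ℂ) * (cesaroNumber b (l - j) : ℂ) *
        doubleCoeff m f i j * psi m i z.1 * psi m j z.2

/-- Membership in `L^p(G_m × G_m)`, with the convention `L^∞ = C`. -/
def MemL (m : ℕ → ℕ) [∀ k, NeZero (m k)] (p : ℝ≥0∞) (f : VGroup m × VGroup m → ℂ) : Prop :=
  if p = ∞ then Continuous f else MemLp f p (haar2 m)

/-- The norm of `L^p(G_m × G_m)`: the usual one for `p < ∞`, the supremum norm for `p = ∞`. -/
def normL (m : ℕ → ℕ) [∀ k, NeZero (m k)] (p : ℝ≥0∞) (f : VGroup m × VGroup m → ℂ) : ℝ≥0∞ :=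
  if p = ∞ then ⨆ z, ‖f z‖ₑ else eLpNorm f p (haar2 m)

/-- The total modulus of continuity `ω(f, 1 / M_n)_p`, the supremum over `(u, v) ∈ I_n × I_n` of
`‖f(· - u, · - v) - f‖_p`. -/
def modulus (m : ℕ → ℕ) [∀ k, NeZero (m k)] (p : ℝ≥0∞) (f : VGroup m × VGroup m → ℂ)
    (n : ℕ) : ℝ≥0∞ :=
  ⨆ u ∈ I m n, ⨆ v ∈ I m n, normL m p (fun z => f (z.1 - u, z.2 - v) - f z)

end Vilenkin

end

set_option linter.unusedSectionVars false

namespace Vilenkin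

/-! ### Invariance of the Haar measures. -/

section Group

variable (m : ℕ → ℕ) [∀ k, NeZero (m k)]

/-! In one variable write `σ` for the Cesàro mean of order `-α` and `S_r` for the partial sum of
order `M_r`, which is averaging over `I_r`. Two kernel bounds carry the proof. The kernel of `σ_n`
has `L¹` norm `O(n^α)` (`exists_l1_cesaroWeight_le`). The multiplier of `σ_n - 1`, cut off at `N ≤
n/2`, has a kernel of `L¹` norm `O(N^α · N/n)`, because the Cesàro weights vary slowly at low
frequencies (`exists_l1_cesaroWeight_sub_one_le`).

For `M_{κ+1} ≤ n < M_{κ+2}`, telescoping over the scales `M_r` bounds `‖σ_n f - f‖` by a constant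
times `∑_{r ≤ κ} 2^{-(κ-r)} M_r^α ‖f - S_r f‖` (`exists_norm_cesaro_sub_le`).

In two variables, with `σ'`, `S'_t` acting on the second one, `σσ' - 1 = (σ-1)(σ'-1) + (σ-1) +
(σ'-1)`. The mixed term is handled by using the one-variable estimate twice, which leaves `M_r^α
M_t^β ‖(1-S_r)(1-S'_t)f‖`. The larger of the two scales can take the whole exponent `α + β`, and the
modulus of continuity at that scale controls the product. Everything is then bounded by
geometrically weighted averages of a null sequence, which tend to zero
(`exists_norm_cesaro_cesaro_sub_le`, `tendsto_geomAverage`).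

The operators are built as Bochner integrals on `C(G_m × G_m)`, where they have pointwise meaning,
while norms are measured after a map `Φ` into `C` or `L^p`; this treats all `p` together. A general
`f` is reached by approximating it by continuous functions with `n` and `l` fixed. -/

instance haar_isProbabilityMeasure : IsProbabilityMeasure (haar m) := by
  unfold haar; infer_instance

instance haar2_isProbabilityMeasure : IsProbabilityMeasure (haar2 m) := by
  unfold haar2; infer_instance

instance coordMeasure_isAddLeftInvariant (k : ℕ) :
    (coordMeasure m k).IsAddLeftInvariant := by
  unfold coordMeasure; infer_instance

instance haar_isAddLeftInvariant : (haar m).IsAddLeftInvariant := by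
  constructor
  intro g
  have h := Measure.infinitePi_map_pi (μ := coordMeasure m)
    (f := fun k x => g k + x) (fun k => measurable_const_add (g k))
  simp only [map_add_left_eq_self] at h
  exact h

instance haar2_isAddLeftInvariant : (haar2 m).IsAddLeftInvariant := by
  constructor
  intro g
  exact ((measurePreserving_add_left (haar m) g.1).prod
    (measurePreserving_add_left (haar m) g.2)).map_eq

end Group

/-! ### Vilenkin functions: mixed-radix digits, orthogonality, reflection, Dirichlet kernels. -/

section Characters

variable {m : ℕ → ℕ}

theorem M_pos [∀ k, NeZero (m k)] (k : ℕ) : 0 < M m k := by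
  induction k with
  | zero => simp [M]
  | succ k ih => exact Nat.mul_pos (Nat.pos_of_ne_zero (NeZero.ne _)) ih

theorem two_pow_mul_M_le (hm : ∀ k, 2 ≤ m k) (r k : ℕ) : 2 ^ k * M m r ≤ M m (r + k) := by
  induction k with
  | zero => simp
  | succ k ih =>
    have : M m (r + (k + 1)) = m (r + k) * M m (r + k) := rfl
    rw [this, pow_succ]
    nlinarith [hm (r + k), Nat.mul_le_mul (hm (r + k)) ih]

theorem two_pow_le_M (hm : ∀ k, 2 ≤ m k) (k : ℕ) : 2 ^ k ≤ M m k := by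
  simpa [M] using two_pow_mul_M_le hm 0 k

theorem M_monotone (hm : ∀ k, 2 ≤ m k) : Monotone (M m) := by
  refine monotone_nat_of_le_succ fun k => ?_
  have := two_pow_mul_M_le hm k 1
  omega

theorem lt_M_self (hm : ∀ k, 2 ≤ m k) (n : ℕ) : n < M m n :=
  Nat.lt_two_pow_self.trans_le (two_pow_le_M hm n)

variable [∀ k, NeZero (m k)]

theorem rademacher_eq_toCircle (k : ℕ) (x : VGroup m) :
    rademacher m k x = (ZMod.toCircle (x k) : ℂ) := by
  rw [ZMod.toCircle_apply, rademacher]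

theorem rademacher_add (k : ℕ) (x y : VGroup m) :
    rademacher m k (x + y) = rademacher m k x * rademacher m k y := by
  simp [rademacher_eq_toCircle, AddChar.map_add_eq_mul]

theorem norm_rademacher (k : ℕ) (x : VGroup m) : ‖rademacher m k x‖ = 1 := by
  rw [rademacher_eq_toCircle, Circle.norm_coe]

theorem rademacher_pow_card (k : ℕ) (x : VGroup m) : rademacher m k x ^ m k = 1 := by
  rw [rademacher_eq_toCircle, ← Circle.coe_pow, ← AddChar.map_nsmul_eq_pow]
  simp

theorem continuous_rademacher (k : ℕ) : Continuous (rademacher m k) := by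
  have : rademacher m k = (fun a : ZMod (m k) => (ZMod.toCircle a : ℂ)) ∘ fun x => x k :=
    funext fun x => rademacher_eq_toCircle k x
  rw [this]
  exact continuous_of_discreteTopology.comp (continuous_apply k)

theorem rademacher_eq_one_iff (k : ℕ) (x : VGroup m) : rademacher m k x = 1 ↔ x k = 0 := by
  rw [rademacher_eq_toCircle]
  constructor
  · intro h
    apply ZMod.injective_toCircle
    apply Circle.coe_injective
    simpa using h
  · intro h; simp [h]

theorem psi_add (n : ℕ) (x y : VGroup m) : psi m n (x + y) = psi m n x * psi m n y := by
  simp only [psi, rademacher_add, mul_pow, Finset.prod_mul_distrib]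

theorem norm_psi (n : ℕ) (x : VGroup m) : ‖psi m n x‖ = 1 := by
  simp [psi, norm_rademacher]

theorem continuous_psi (n : ℕ) : Continuous (psi m n) :=
  continuous_finsetProd _ fun k _ => (continuous_rademacher k).pow _

theorem psi_zero (x : VGroup m) : psi m 0 x = 1 := by simp [psi]

theorem digit_eq_zero (hm : ∀ k, 2 ≤ m k) {n K k : ℕ} (hn : n < M m K) (hk : K ≤ k) :
    digit m n k = 0 := by
  rw [digit, Nat.div_eq_of_lt (hn.trans_le (M_monotone hm hk)), Nat.zero_mod]

theorem psi_eq_prod (hm : ∀ k, 2 ≤ m k) {n K : ℕ} (hn : n < M m K) (x : VGroup m) :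
    psi m n x = ∏ k ∈ Finset.range K, rademacher m k x ^ digit m n k := by
  have key : ∀ {a b : ℕ}, a ≤ b → n < M m a →
      ∏ k ∈ Finset.range b, rademacher m k x ^ digit m n k
        = ∏ k ∈ Finset.range a, rademacher m k x ^ digit m n k := by
    intro a b hab ha
    refine (Finset.prod_subset (Finset.range_mono hab) fun k _ hk => ?_).symm
    rw [digit_eq_zero hm ha (by simpa using hk), pow_zero]
  rw [psi]
  rcases le_total n K with h | h
  · exact (key h (lt_M_self hm n)).symm
  · exact key h hn

theorem M_dvd_M {k l : ℕ} (h : k ≤ l) : M m k ∣ M m l := by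
  induction l, h using Nat.le_induction with
  | base => exact dvd_rfl
  | succ l _ ih => exact ih.trans (Dvd.intro_left _ rfl)

theorem digit_mul_M_add_of_lt {k l j i : ℕ} (hl : l < k) :
    digit m (j * M m k + i) l = digit m i l := by
  obtain ⟨c, hc⟩ := M_dvd_M (m := m) (Nat.succ_le_of_lt hl)
  have : M m (l + 1) = m l * M m l := rfl
  rw [digit, digit, hc, Nat.succ_eq_add_one, this]
  have e : j * (m l * M m l * c) + i = i + M m l * (m l * (j * c)) := by ring
  rw [e, Nat.add_mul_div_left _ _ (M_pos l), Nat.add_mul_mod_self_left]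

theorem digit_mul_M_add {k j i : ℕ} (hj : j < m k) (hi : i < M m k) :
    digit m (j * M m k + i) k = j := by
  rw [digit, Nat.add_comm, Nat.add_mul_div_right _ _ (M_pos k), Nat.div_eq_of_lt hi, Nat.zero_add,
    Nat.mod_eq_of_lt hj]

theorem mul_M_add_lt {k j i : ℕ} (hj : j < m k) (hi : i < M m k) :
    j * M m k + i < M m (k + 1) := by
  have : M m (k + 1) = m k * M m k := rfl
  rw [this]
  nlinarith [Nat.mul_le_mul_right (M m k) (Nat.succ_le_of_lt hj)]

theorem psi_mul_M_add (hm : ∀ k, 2 ≤ m k) {k j i : ℕ} (hj : j < m k) (hi : i < M m k)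
    (x : VGroup m) :
    psi m (j * M m k + i) x = rademacher m k x ^ j * psi m i x := by
  rw [psi_eq_prod hm (mul_M_add_lt hj hi), psi_eq_prod hm hi, Finset.prod_range_succ,
    digit_mul_M_add hj hi, mul_comm]
  congr 1
  refine Finset.prod_congr rfl fun l hl => ?_
  rw [digit_mul_M_add_of_lt (Finset.mem_range.1 hl)]

/-- Every `n < M_{k+1}` splits off its leading digit. -/
theorem exists_leading_digit {k n : ℕ} (hn : n < M m (k + 1)) :
    ∃ j i, j < m k ∧ i < M m k ∧ n = j * M m k + i := by
  refine ⟨n / M m k, n % M m k, ?_, Nat.mod_lt _ (M_pos k), (Nat.div_add_mod' _ _).symm⟩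
  exact Nat.div_lt_of_lt_mul (by rw [mul_comm]; exact hn)

/-- The generator of the `k`-th factor reads off the `k`-th digit, so the characters `ψ_n` separate
indices. -/
theorem psi_single (hm : ∀ k, 2 ≤ m k) (n k : ℕ) :
    psi m n (Pi.single k 1) = (ZMod.toCircle ((digit m n k : ℕ) : ZMod (m k)) : ℂ) := by
  have hn : n < M m (n + k + 1) := (lt_M_self hm n).trans_le (M_monotone hm (by omega))
  rw [psi_eq_prod hm hn, Finset.prod_eq_single k]
  · rw [rademacher_eq_toCircle, Pi.single_eq_same, ← Circle.coe_pow, ← AddChar.map_nsmul_eq_pow]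
    simp
  · intro l _ hl
    rw [(rademacher_eq_one_iff l _).2 (Pi.single_eq_of_ne hl _), one_pow]
  · intro h; simp at h

theorem digit_lt (n k : ℕ) : digit m n k < m k :=
  Nat.mod_lt _ (Nat.pos_of_ne_zero (NeZero.ne _))

theorem eq_of_digit_eq {K : ℕ} : ∀ {i j : ℕ}, i < M m K → j < M m K →
    (∀ k < K, digit m i k = digit m j k) → i = j := by
  induction K with
  | zero => intro i j hi hj _; simp [M] at hi hj; omega
  | succ K ih =>
    intro i j hi hj h
    obtain ⟨a, i', ha, hi', rfl⟩ := exists_leading_digit hi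
    obtain ⟨b, j', hb, hj', rfl⟩ := exists_leading_digit hj
    have hab := h K (Nat.lt_succ_self K)
    rw [digit_mul_M_add ha hi', digit_mul_M_add hb hj'] at hab
    have : i' = j' := ih hi' hj' fun k hk => by
      have := h k (hk.trans (Nat.lt_succ_self K))
      rwa [digit_mul_M_add_of_lt hk, digit_mul_M_add_of_lt hk] at this
    rw [hab, this]

theorem exists_psi_ne (hm : ∀ k, 2 ≤ m k) {i j : ℕ} (hij : i ≠ j) :
    ∃ x : VGroup m, psi m i x ≠ psi m j x := by
  by_contra! h
  have hlt : ∀ n ≤ i + j, n < M m (i + j) := fun n hn =>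
    (lt_M_self hm n).trans_le (M_monotone hm hn)
  refine hij (eq_of_digit_eq (hlt i (by omega)) (hlt j (by omega)) fun k _ => ?_)
  have := h (Pi.single k 1)
  rw [psi_single hm, psi_single hm] at this
  have := ZMod.injective_toCircle (Circle.coe_injective this)
  rw [ZMod.natCast_eq_natCast_iff'] at this
  rwa [Nat.mod_eq_of_lt (digit_lt i k), Nat.mod_eq_of_lt (digit_lt j k)] at this

theorem star_psi_mul_self (n : ℕ) (x : VGroup m) : star (psi m n x) * psi m n x = 1 := by
  have := Complex.conj_mul' (psi m n x)
  rw [norm_psi] at this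
  simpa using this

/-- Translating by `v` multiplies the integral by `conj ψ_i(v) ψ_j(v)`. If `ψ_i(v) ≠ ψ_j(v)` this
factor is not `1`, which forces the integral to vanish. -/
theorem integral_star_psi_mul_psi (hm : ∀ k, 2 ≤ m k) (i j : ℕ) :
    ∫ x, star (psi m i x) * psi m j x ∂(haar m) = if i = j then 1 else 0 := by
  split_ifs with h
  · subst h; simp only [star_psi_mul_self]; simp
  · obtain ⟨v, hv⟩ := exists_psi_ne hm h
    set J := ∫ x, star (psi m i x) * psi m j x ∂(haar m) with hJ
    have e : J = (star (psi m i v) * psi m j v) * J := by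
      conv_lhs => rw [hJ, ← integral_add_left_eq_self _ v]
      rw [hJ, ← integral_const_mul]
      congr 1; ext x
      simp only [psi_add, star_mul']; ring
    by_contra hJ0
    have h1 : star (psi m i v) * psi m j v = 1 := mul_right_cancel₀ hJ0 (by rw [← e, one_mul])
    apply hv
    have h2 := star_psi_mul_self i v
    have h3 : star (psi m i v) ≠ 0 := fun h0 => by simp [h0] at h1
    exact mul_left_cancel₀ h3 (h2.trans h1.symm)

/-- All digits of `M_k - 1` below place `k` are maximal, so subtracting `s` involves no borrowing
and complements each digit; for unimodular `r_l` this is conjugation up to the common factor `ψ_{M_k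
- 1}`. -/
theorem psi_reverse (hm : ∀ k, 2 ≤ m k) (k : ℕ) : ∀ {s : ℕ}, s < M m k → ∀ x : VGroup m,
    psi m (M m k - 1 - s) x = psi m (M m k - 1) x * star (psi m s x) := by
  induction k with
  | zero => intro s hs x; simp [M] at hs; subst hs; simp [M, psi_zero]
  | succ k ih =>
    intro s hs x
    obtain ⟨j, i, hj, hi, rfl⟩ := exists_leading_digit hs
    have hMk := M_pos (m := m) k
    have hM : M m (k + 1) = m k * M m k := rfl
    have hsplit : ∀ a b, a < m k → b < M m k →
        M m (k + 1) - 1 - (a * M m k + b) = (m k - 1 - a) * M m k + (M m k - 1 - b) := by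
      intro a b ha hb
      obtain ⟨c, hc⟩ := Nat.exists_eq_add_of_lt ha
      obtain ⟨d, hd⟩ := Nat.exists_eq_add_of_lt hb
      have e1 : m k - 1 - a = c := by omega
      have e2 : M m k - 1 - b = d := by omega
      rw [e1, e2, hM]
      have : m k * M m k = a * M m k + b + (c * M m k + d) + 1 := by
        have : m k * M m k = a * M m k + c * M m k + M m k := by rw [hc]; ring
        omega
      omega
    have h0 : M m (k + 1) - 1 = (m k - 1) * M m k + (M m k - 1) := by
      simpa using hsplit 0 0 (by omega) hMk
    rw [hsplit j i hj hi, h0, psi_mul_M_add hm (by omega) (by omega),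
      psi_mul_M_add hm (by omega) (by omega), psi_mul_M_add hm hj hi, ih hi]
    have hr : rademacher m k x ^ (m k - 1 - j) = rademacher m k x ^ (m k - 1)
        * star (rademacher m k x ^ j) := by
      have e : m k - 1 = (m k - 1 - j) + j := by omega
      conv_rhs => rw [e, pow_add, mul_assoc]
      have := Complex.mul_conj' (rademacher m k x ^ j)
      rw [norm_pow, norm_rademacher] at this
      rw [Complex.star_def, this]; simp
    rw [hr, star_mul']; ring

theorem sum_range_mul_eq_sum_sum {A : Type*} [AddCommMonoid A] (f : ℕ → A) (a N : ℕ) :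
    ∑ i ∈ Finset.range (a * N), f i
      = ∑ j ∈ Finset.range a, ∑ i ∈ Finset.range N, f (j * N + i) := by
  induction a with
  | zero => simp
  | succ a ih => rw [add_mul, one_mul, Finset.sum_range_add, ih, Finset.sum_range_succ]

theorem sum_psi_range_mul_M (hm : ∀ k, 2 ≤ m k) {k a : ℕ} (ha : a ≤ m k) (x : VGroup m) :
    ∑ i ∈ Finset.range (a * M m k), psi m i x
      = (∑ j ∈ Finset.range a, rademacher m k x ^ j)
        * ∑ i ∈ Finset.range (M m k), psi m i x := by
  rw [sum_range_mul_eq_sum_sum, Finset.sum_mul]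
  refine Finset.sum_congr rfl fun j hj => ?_
  rw [Finset.mul_sum]
  refine Finset.sum_congr rfl fun i hi => ?_
  rw [psi_mul_M_add hm ((Finset.mem_range.1 hj).trans_le ha) (Finset.mem_range.1 hi)]

/-- The Dirichlet kernel of order `M_k` is `M_k` times the indicator of `I_k`. -/
theorem sum_psi_range_M (hm : ∀ k, 2 ≤ m k) (k : ℕ) (x : VGroup m) :
    ∑ i ∈ Finset.range (M m k), psi m i x = (I m k).indicator (fun _ => (M m k : ℂ)) x := by
  classical
  induction k with
  | zero => simp [M, psi_zero, I]
  | succ k ih =>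
    have hM : M m (k + 1) = m k * M m k := rfl
    rw [hM, sum_psi_range_mul_M hm le_rfl, ih]
    have hI : x ∈ I m (k + 1) ↔ x k = 0 ∧ x ∈ I m k := by
      simp only [I, Set.mem_ofPred_eq, Nat.lt_succ_iff_lt_or_eq]
      constructor
      · intro h; exact ⟨h k (Or.inr rfl), fun l hl => h l (Or.inl hl)⟩
      · rintro ⟨h, h'⟩ l (hl | rfl)
        exacts [h' l hl, h]
    by_cases h0 : x k = 0
    · rw [(rademacher_eq_one_iff k x).2 h0]
      simp [hI, h0, Set.indicator_apply]
    · have h1 := mt (rademacher_eq_one_iff k x).1 h0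
      rw [geom_sum_eq h1, rademacher_pow_card]
      simp [hI, h0, Set.indicator_apply]

end Characters

/-! ### Two-sided power bounds for the Cesàro numbers of order `-α`. -/

section CesaroNumbers

variable {α : ℝ}

theorem cesaroNumber_zero : cesaroNumber (-α) 0 = 1 := by simp [cesaroNumber]

theorem cesaroNumber_succ (t : ℕ) :
    cesaroNumber (-α) (t + 1) = cesaroNumber (-α) t * (1 - α / (t + 1)) := by
  have h1 : ((t : ℝ) + 1) ≠ 0 := by positivity
  have h2 : (t.factorial : ℝ) ≠ 0 := by positivity
  rw [cesaroNumber, cesaroNumber, Finset.prod_range_succ, Nat.factorial_succ]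
  push_cast
  field_simp
  ring

theorem one_sub_div_pos (hα : α ∈ Set.Ioo (0 : ℝ) 1) (t : ℕ) : 0 < 1 - α / ((t : ℝ) + 1) := by
  rw [sub_pos, div_lt_one (by positivity)]
  have : (0 : ℝ) ≤ t := Nat.cast_nonneg t
  linarith [hα.2]

theorem cesaroNumber_pos (hα : α ∈ Set.Ioo (0 : ℝ) 1) (t : ℕ) : 0 < cesaroNumber (-α) t := by
  induction t with
  | zero => simp [cesaroNumber_zero]
  | succ t ih => rw [cesaroNumber_succ]; exact mul_pos ih (one_sub_div_pos hα t)

theorem cesaroNumber_sub_succ (t : ℕ) :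
    cesaroNumber (-α) t - cesaroNumber (-α) (t + 1) = α / (t + 1) * cesaroNumber (-α) t := by
  rw [cesaroNumber_succ]; ring

theorem cesaroNumber_antitone (hα : α ∈ Set.Ioo (0 : ℝ) 1) : Antitone (cesaroNumber (-α)) := by
  refine antitone_nat_of_succ_le fun t => ?_
  have h := cesaroNumber_sub_succ (α := α) t
  have := mul_nonneg (div_nonneg hα.1.le (by positivity : (0 : ℝ) ≤ t + 1))
    (cesaroNumber_pos hα t).le
  linarith

/-- Compare successive ratios: with `x = 1/(t+1)`, Bernoulli gives `(1+x)^α ≤ 1 + αx`, and `(1 -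
αx)(1 + αx) ≤ 1`. -/
theorem cesaroNumber_le (hα : α ∈ Set.Ioo (0 : ℝ) 1) (t : ℕ) :
    cesaroNumber (-α) t ≤ ((t : ℝ) + 1) ^ (-α) := by
  induction t with
  | zero => simp [cesaroNumber_zero]
  | succ t ih =>
    have hpos : (0 : ℝ) < t + 1 := by positivity
    have h1 : (1 + 1 / ((t : ℝ) + 1)) ^ α ≤ 1 + α * (1 / ((t : ℝ) + 1)) :=
      rpow_one_add_le_one_add_mul_self (by linarith [one_div_pos.2 hpos]) hα.1.le hα.2.le
    have h2 : 1 - α / ((t : ℝ) + 1) ≤ (1 + 1 / ((t : ℝ) + 1)) ^ (-α) := by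
      rw [Real.rpow_neg (by positivity)]
      have h3 : 0 < (1 + 1 / ((t : ℝ) + 1)) ^ α := by positivity
      rw [le_inv_comm₀ (one_sub_div_pos hα t) h3]
      refine h1.trans ?_
      rw [le_inv_comm₀ (by have := hα.1; positivity) (one_sub_div_pos hα t)]
      rw [← one_div, le_div_iff₀ (by have := hα.1; positivity)]
      have : α * (1 / ((t : ℝ) + 1)) = α / (t + 1) := by ring
      rw [this]
      nlinarith [sq_nonneg (α / ((t : ℝ) + 1))]
    rw [cesaroNumber_succ]
    calc cesaroNumber (-α) t * (1 - α / ((t : ℝ) + 1))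
        ≤ ((t : ℝ) + 1) ^ (-α) * (1 + 1 / ((t : ℝ) + 1)) ^ (-α) :=
          mul_le_mul ih h2 (one_sub_div_pos hα t).le (by positivity)
      _ = (((t + 1 : ℕ) : ℝ) + 1) ^ (-α) := by
          rw [← Real.mul_rpow hpos.le (by positivity)]
          congr 1; push_cast; field_simp

/-- Again a comparison of ratios, through `(1-x)^α ≤ 1 - αx` with `x = 1/(t+1)`. The constant is the
value at `t = 1`. -/
theorem le_cesaroNumber (hα : α ∈ Set.Ioo (0 : ℝ) 1) {t : ℕ} (ht : 1 ≤ t) :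
    (1 - α) * (t : ℝ) ^ (-α) ≤ cesaroNumber (-α) t := by
  induction t, ht using Nat.le_induction with
  | base => rw [cesaroNumber_succ]; simp [cesaroNumber_zero]
  | succ t ht ih =>
    have ht0 : (0 : ℝ) < t := by exact_mod_cast ht
    have hpos : (0 : ℝ) < t + 1 := by positivity
    have h1 : (1 + -(1 / ((t : ℝ) + 1))) ^ α ≤ 1 + α * -(1 / ((t : ℝ) + 1)) := by
      refine rpow_one_add_le_one_add_mul_self ?_ hα.1.le hα.2.le
      rw [neg_le_neg_iff, div_le_one hpos]; linarith
    have h2 : ((t : ℝ) + 1) ^ (-α) = (t : ℝ) ^ (-α) * (1 + -(1 / ((t : ℝ) + 1))) ^ α := by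
      have : (1 + -(1 / ((t : ℝ) + 1))) = t / (t + 1) := by field_simp; ring
      rw [this, Real.div_rpow ht0.le hpos.le, Real.rpow_neg ht0.le, Real.rpow_neg hpos.le]
      have := (Real.rpow_pos_of_pos ht0 α).ne'
      field_simp
    rw [cesaroNumber_succ]
    push_cast
    rw [h2, ← mul_assoc]
    refine mul_le_mul ih (h1.trans (le_of_eq (by ring))) (Real.rpow_nonneg ?_ _)
      (cesaroNumber_pos hα t).le
    have : (1 + -(1 / ((t : ℝ) + 1))) = t / (t + 1) := by field_simp; ring
    rw [this]; positivity

theorem cesaroNumber_sub_succ_le (hα : α ∈ Set.Ioo (0 : ℝ) 1) (t : ℕ) :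
    |cesaroNumber (-α) t - cesaroNumber (-α) (t + 1)| ≤ ((t : ℝ) + 1) ^ (-1 - α) := by
  have hpos : (0 : ℝ) < t + 1 := by positivity
  rw [cesaroNumber_sub_succ, abs_of_nonneg (mul_nonneg (div_nonneg hα.1.le hpos.le)
    (cesaroNumber_pos hα t).le), sub_eq_add_neg, Real.rpow_add hpos, Real.rpow_neg_one]
  refine mul_le_mul ?_ (cesaroNumber_le hα t) (cesaroNumber_pos hα t).le (by positivity)
  rw [div_eq_mul_inv]
  exact mul_le_of_le_one_left (by positivity) hα.2.le

/-- The Cesàro numbers of order `-δ` replace an integral comparison: their consecutive differences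
dominate `δ(1-δ)(t+1)^{-1-δ}` and telescope. -/
theorem sum_rpow_tail_le {δ : ℝ} (hδ : δ ∈ Set.Ioo (0 : ℝ) 1) {c : ℕ} (hc : 1 ≤ c) (N : ℕ) :
    ∑ s ∈ Finset.range N, ((c : ℝ) + s + 1) ^ (-1 - δ)
      ≤ (δ * (1 - δ))⁻¹ * (c : ℝ) ^ (-δ) := by
  have hd : 0 < δ * (1 - δ) := mul_pos hδ.1 (by linarith [hδ.2])
  have hc0 : (0 : ℝ) < c := by exact_mod_cast hc
  have key : ∀ s ∈ Finset.range N, ((c : ℝ) + s + 1) ^ (-1 - δ) ≤ (δ * (1 - δ))⁻¹ *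
      (cesaroNumber (-δ) (c + s) - cesaroNumber (-δ) (c + (s + 1))) := by
    intro s _
    have h0 : (0 : ℝ) < (c : ℝ) + s := by positivity
    have h1 : (0 : ℝ) < (c : ℝ) + s + 1 := by positivity
    rw [← add_assoc, cesaroNumber_sub_succ, le_inv_mul_iff₀ hd,
      sub_eq_add_neg (-1 : ℝ) δ, Real.rpow_add h1, Real.rpow_neg_one]
    have h2 := le_cesaroNumber hδ (t := c + s) (by omega)
    have h3 : ((c : ℝ) + s + 1) ^ (-δ) ≤ ((c : ℝ) + s) ^ (-δ) :=
      Real.rpow_le_rpow_of_nonpos h0 (by linarith) (by linarith [hδ.1])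
    push_cast at h2 ⊢
    calc δ * (1 - δ) * (((c : ℝ) + s + 1)⁻¹ * ((c : ℝ) + s + 1) ^ (-δ))
        = δ / ((c : ℝ) + s + 1) * ((1 - δ) * ((c : ℝ) + s + 1) ^ (-δ)) := by ring
      _ ≤ δ / ((c : ℝ) + s + 1) * cesaroNumber (-δ) (c + s) := by
          refine mul_le_mul_of_nonneg_left (le_trans ?_ h2) (div_nonneg hδ.1.le h1.le)
          exact mul_le_mul_of_nonneg_left h3 (by linarith [hδ.2])
  refine (Finset.sum_le_sum key).trans ?_
  rw [← Finset.mul_sum, Finset.sum_range_sub' (fun s => cesaroNumber (-δ) (c + s))]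
  refine mul_le_mul_of_nonneg_left ?_ (inv_nonneg.2 hd.le)
  have h1 := cesaroNumber_pos hδ (c + N)
  have h2 := cesaroNumber_le hδ c
  have h3 : ((c : ℝ) + 1) ^ (-δ) ≤ (c : ℝ) ^ (-δ) :=
    Real.rpow_le_rpow_of_nonpos hc0 (by linarith) (by linarith [hδ.1])
  simp only [add_zero]; linarith

end CesaroNumbers

/-! ### `L¹` norms of Dirichlet kernels and of the unnormalized Cesàro kernels. -/

section Kernels

variable {m : ℕ → ℕ} [∀ k, NeZero (m k)]

/-- The Vilenkin function `ψ_n` as a bundled continuous function. -/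
noncomputable def psiC (m : ℕ → ℕ) [∀ k, NeZero (m k)] (n : ℕ) : C(VGroup m, ℂ) :=
  ⟨psi m n, continuous_psi n⟩

@[simp] theorem psiC_apply (n : ℕ) (x : VGroup m) : psiC m n x = psi m n x := rfl

/-- The `L¹` norm of a continuous function on the Vilenkin group. -/
noncomputable def l1 (K : C(VGroup m, ℂ)) : ℝ := ∫ x, ‖K x‖ ∂(haar m)

theorem integrable_continuousMap {E : Type*} [NormedAddCommGroup E] (K : C(VGroup m, E)) :
    Integrable K (haar m) :=
  K.continuous.integrable_of_hasCompactSupport (HasCompactSupport.of_compactSpace K)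

theorem l1_nonneg (K : C(VGroup m, ℂ)) : 0 ≤ l1 K := integral_nonneg fun _ => norm_nonneg _

theorem l1_add_le (K L : C(VGroup m, ℂ)) : l1 (K + L) ≤ l1 K + l1 L := by
  rw [l1, l1, l1, ← integral_add (integrable_continuousMap K).norm
    (integrable_continuousMap L).norm]
  exact integral_mono (integrable_continuousMap (K + L)).norm
    ((integrable_continuousMap K).norm.add (integrable_continuousMap L).norm)
    fun x => norm_add_le _ _

theorem l1_sum_le {ι : Type*} (s : Finset ι) (K : ι → C(VGroup m, ℂ)) :
    l1 (∑ i ∈ s, K i) ≤ ∑ i ∈ s, l1 (K i) :=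
  Finset.le_sum_of_subadditive _ (by simp [l1]) l1_add_le _ _

theorem l1_smul (c : ℂ) (K : C(VGroup m, ℂ)) : l1 (c • K) = ‖c‖ * l1 K := by
  simp [l1, integral_const_mul]

theorem l1_mul_of_norm_eq_one {u : C(VGroup m, ℂ)} (hu : ∀ x, ‖u x‖ = 1) (K : C(VGroup m, ℂ)) :
    l1 (u * K) = l1 K := by
  simp [l1, hu]

theorem l1_star (K : C(VGroup m, ℂ)) : l1 (star K) = l1 K := by simp [l1]

theorem l1_psiC (n : ℕ) : l1 (psiC m n) = 1 := by simp [l1, norm_psi]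

/-- The Dirichlet kernel `D_n = ∑_{i < n} ψ_i`. -/
noncomputable def dirichlet (m : ℕ → ℕ) [∀ k, NeZero (m k)] (n : ℕ) : C(VGroup m, ℂ) :=
  ∑ i ∈ Finset.range n, psiC m i

theorem dirichlet_M_apply (hm : ∀ k, 2 ≤ m k) (k : ℕ) (x : VGroup m) :
    dirichlet m (M m k) x = (I m k).indicator (fun _ => (M m k : ℂ)) x := by
  simp [dirichlet, ← sum_psi_range_M hm]

theorem coe_norm_dirichlet_M (hm : ∀ k, 2 ≤ m k) (k : ℕ) (x : VGroup m) :
    (‖dirichlet m (M m k) x‖ : ℂ) = dirichlet m (M m k) x := by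
  rw [dirichlet_M_apply hm]
  by_cases h : x ∈ I m k <;> simp [h]

theorem integral_psi (hm : ∀ k, 2 ≤ m k) (i : ℕ) :
    ∫ x, psi m i x ∂(haar m) = if i = 0 then 1 else 0 := by
  have := integral_star_psi_mul_psi hm 0 i
  simpa [psi_zero, eq_comm] using this

theorem integral_dirichlet_M (hm : ∀ k, 2 ≤ m k) (k : ℕ) :
    ∫ x, dirichlet m (M m k) x ∂(haar m) = 1 := by
  simp only [dirichlet, ContinuousMap.sum_apply]
  rw [integral_finsetSum _ fun i _ => integrable_continuousMap (psiC m i)]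
  simp [integral_psi hm, (M_pos (m := m) k).ne']

theorem l1_dirichlet_M (hm : ∀ k, 2 ≤ m k) (k : ℕ) : l1 (dirichlet m (M m k)) = 1 := by
  have h : ((l1 (dirichlet m (M m k)) : ℝ) : ℂ) = 1 := by
    rw [l1, ← integral_complex_ofReal]
    simp only [coe_norm_dirichlet_M hm, integral_dirichlet_M hm]
  exact_mod_cast h

/-- The bundled Rademacher function. -/
noncomputable def rademacherC (m : ℕ → ℕ) [∀ k, NeZero (m k)] (k : ℕ) : C(VGroup m, ℂ) :=
  ⟨rademacher m k, continuous_rademacher k⟩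

theorem norm_rademacherC_pow (k j : ℕ) (x : VGroup m) : ‖(rademacherC m k ^ j) x‖ = 1 := by
  simp [rademacherC, norm_rademacher]

theorem psiC_mul_M_add (hm : ∀ k, 2 ≤ m k) {k j i : ℕ} (hj : j < m k) (hi : i < M m k) :
    psiC m (j * M m k + i) = rademacherC m k ^ j * psiC m i := by
  ext x; simp [psi_mul_M_add hm hj hi, rademacherC]

/-- Splitting a weighted sum of Vilenkin functions along the leading digit. -/
theorem sum_smul_psiC_split (hm : ∀ k, 2 ≤ m k) {k j i : ℕ} (hj : j < m k) (hi : i ≤ M m k)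
    (a : ℕ → ℂ) :
    ∑ s ∈ Finset.range (j * M m k + i), a s • psiC m s
      = (∑ b ∈ Finset.range j, rademacherC m k ^ b *
          ∑ s ∈ Finset.range (M m k), a (b * M m k + s) • psiC m s)
        + rademacherC m k ^ j * ∑ s ∈ Finset.range i, a (j * M m k + s) • psiC m s := by
  rw [Finset.sum_range_add, sum_range_mul_eq_sum_sum]
  congr 1
  · refine Finset.sum_congr rfl fun b hb => ?_
    rw [Finset.mul_sum]
    refine Finset.sum_congr rfl fun s hs => ?_
    rw [psiC_mul_M_add hm ((Finset.mem_range.1 hb).trans hj) (Finset.mem_range.1 hs),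
      mul_smul_comm]
  · rw [Finset.mul_sum]
    refine Finset.sum_congr rfl fun s hs => ?_
    rw [psiC_mul_M_add hm hj ((Finset.mem_range.1 hs).trans_le hi), mul_smul_comm]

/-- The factors `r_k^b` are unimodular and drop out of the `L¹` norm, so each block with a fixed
leading digit can be estimated separately. -/
theorem l1_sum_smul_psiC_split_le (hm : ∀ k, 2 ≤ m k) {k j i : ℕ} (hj : j < m k)
    (hi : i ≤ M m k) (a : ℕ → ℂ) {C : ℝ}
    (hC : ∀ b < j, l1 (∑ s ∈ Finset.range (M m k), a (b * M m k + s) • psiC m s) ≤ C) :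
    l1 (∑ s ∈ Finset.range (j * M m k + i), a s • psiC m s)
      ≤ j * C + l1 (∑ s ∈ Finset.range i, a (j * M m k + s) • psiC m s) := by
  rw [sum_smul_psiC_split hm hj hi]
  refine (l1_add_le _ _).trans (add_le_add ?_ ?_)
  · refine (l1_sum_le _ _).trans ?_
    calc _ ≤ ∑ b ∈ Finset.range j, C := Finset.sum_le_sum fun b hb => by
            rw [l1_mul_of_norm_eq_one (norm_rademacherC_pow k b)]
            exact hC b (Finset.mem_range.1 hb)
      _ = j * C := by simp
  · rw [l1_mul_of_norm_eq_one (norm_rademacherC_pow k j)]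

/-- Logarithmic growth: each digit place contributes at most `B` full blocks, copies of `D_{M_k}`,
which has norm one. -/
theorem l1_dirichlet_le (hm : ∀ k, 2 ≤ m k) {B : ℕ} (hB : ∀ k, m k ≤ B) (k : ℕ) :
    ∀ {n : ℕ}, n < M m k → l1 (dirichlet m n) ≤ B * k := by
  induction k with
  | zero => intro n hn; simp [M] at hn; subst hn; simp [dirichlet, l1]
  | succ k ih =>
    intro n hn
    obtain ⟨j, i, hj, hi, rfl⟩ := exists_leading_digit hn
    have h := l1_sum_smul_psiC_split_le hm hj hi.le (fun _ => 1) (C := 1) (fun b _ => by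
      simpa [dirichlet] using (l1_dirichlet_M hm k).le)
    have h2 := ih hi
    simp only [one_smul] at h
    change l1 (dirichlet m (j * M m k + i)) ≤ j * 1 + l1 (dirichlet m i) at h
    have h3 : (j : ℝ) ≤ B := by exact_mod_cast hj.le.trans (hB k)
    push_cast; linarith

theorem exists_M_le_lt (hm : ∀ k, 2 ≤ m k) {n : ℕ} (hn : 1 ≤ n) :
    ∃ k, M m k ≤ n ∧ n < M m (k + 1) := by
  classical
  have hex : ∃ k, n < M m k := ⟨n, lt_M_self hm n⟩
  have h0 : Nat.find hex ≠ 0 := by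
    intro h0
    have := Nat.find_spec hex
    rw [h0] at this; simp [M] at this; omega
  obtain ⟨k, hk⟩ := Nat.exists_eq_succ_of_ne_zero h0
  refine ⟨k, not_lt.1 (Nat.find_min hex (by omega)), ?_⟩
  have := Nat.find_spec hex
  rwa [hk] at this

theorem exists_add_one_le_two_rpow {δ : ℝ} (hδ : 0 < δ) :
    ∃ C : ℝ, 0 < C ∧ ∀ k : ℕ, (k : ℝ) + 1 ≤ C * ((2 : ℝ) ^ k) ^ δ := by
  have hl : 0 < δ * Real.log 2 := mul_pos hδ (Real.log_pos one_lt_two)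
  refine ⟨1 + (δ * Real.log 2)⁻¹, by positivity, fun k => ?_⟩
  have h1 : ((2 : ℝ) ^ k) ^ δ = Real.exp (k * (δ * Real.log 2)) := by
    rw [← Real.rpow_natCast, ← Real.rpow_mul zero_le_two, Real.rpow_def_of_pos two_pos]
    congr 1; ring
  have h2 := Real.add_one_le_exp (k * (δ * Real.log 2))
  rw [h1]
  calc (k : ℝ) + 1 ≤ (1 + (δ * Real.log 2)⁻¹) * (k * (δ * Real.log 2) + 1) := by
        have : (δ * Real.log 2)⁻¹ * (k * (δ * Real.log 2)) = k := by field_simp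
        have h3 : (0 : ℝ) ≤ k * (δ * Real.log 2) := by positivity
        have h4 : (0 : ℝ) ≤ (δ * Real.log 2)⁻¹ := by positivity
        nlinarith
    _ ≤ _ := mul_le_mul_of_nonneg_left h2 (by positivity)

theorem exists_l1_dirichlet_le_rpow (hm : ∀ k, 2 ≤ m k) {B : ℕ} (hB : ∀ k, m k ≤ B) {δ : ℝ}
    (hδ : 0 < δ) : ∃ C : ℝ, 0 < C ∧ ∀ n : ℕ, 1 ≤ n → l1 (dirichlet m n) ≤ C * (n : ℝ) ^ δ := by
  obtain ⟨C, hC, h⟩ := exists_add_one_le_two_rpow hδ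
  have hB0 : (0 : ℝ) < B := by exact_mod_cast (by linarith [hm 0, hB 0] : 0 < B)
  refine ⟨B * C, by positivity, fun n hn => ?_⟩
  obtain ⟨k, hk, hk'⟩ := exists_M_le_lt hm hn
  have h1 := l1_dirichlet_le hm hB (k + 1) hk'
  have h2 : ((2 : ℝ) ^ k) ^ δ ≤ (n : ℝ) ^ δ :=
    Real.rpow_le_rpow (by positivity) (by exact_mod_cast (two_pow_le_M hm k).trans hk) hδ.le
  push_cast at h1
  calc l1 (dirichlet m n) ≤ B * (k + 1) := h1
    _ ≤ B * (C * ((2 : ℝ) ^ k) ^ δ) := mul_le_mul_of_nonneg_left (h k) hB0.le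
    _ ≤ B * (C * (n : ℝ) ^ δ) := by gcongr
    _ = _ := by ring

/-- Summation by parts. -/
theorem sum_smul_psiC_eq (a : ℕ → ℂ) (N : ℕ) :
    ∑ s ∈ Finset.range (N + 1), a s • psiC m s
      = a N • dirichlet m (N + 1)
        + ∑ s ∈ Finset.range N, (a s - a (s + 1)) • dirichlet m (s + 1) := by
  induction N with
  | zero => simp [dirichlet]
  | succ N ih =>
    rw [Finset.sum_range_succ, ih, Finset.sum_range_succ (n := N)]
    have : dirichlet m (N + 1 + 1) = dirichlet m (N + 1) + psiC m (N + 1) := by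
      simp [dirichlet, Finset.sum_range_succ]
    rw [this]
    module

theorem l1_sum_smul_psiC_le (a : ℕ → ℂ) (N : ℕ) :
    l1 (∑ s ∈ Finset.range (N + 1), a s • psiC m s)
      ≤ ‖a N‖ * l1 (dirichlet m (N + 1))
        + ∑ s ∈ Finset.range N, ‖a s - a (s + 1)‖ * l1 (dirichlet m (s + 1)) := by
  rw [sum_smul_psiC_eq]
  refine (l1_add_le _ _).trans (add_le_add (l1_smul _ _).le ((l1_sum_le _ _).trans ?_))
  exact Finset.sum_le_sum fun s _ => (l1_smul _ _).le

/-- Summation by parts: the differences decay like `(c+s+1)^{-1-α}`. Half of the exponent `α` is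
spent on the logarithmic growth of `‖D_s‖₁`; the other half survives as decay in `c`, uniformly in
`k`. -/
theorem exists_l1_sum_cesaro_shift_le (hm : ∀ k, 2 ≤ m k) {B : ℕ} (hB : ∀ k, m k ≤ B) {α : ℝ}
    (hα : α ∈ Set.Ioo (0 : ℝ) 1) : ∃ C : ℝ, 0 < C ∧ ∀ k c : ℕ, 1 ≤ c →
      l1 (∑ s ∈ Finset.range (M m k), (cesaroNumber (-α) (c + s) : ℂ) • psiC m s)
        ≤ C * (c : ℝ) ^ (-(α / 2)) := by
  have hδ : α / 2 ∈ Set.Ioo (0 : ℝ) 1 := ⟨by linarith [hα.1], by linarith [hα.1, hα.2]⟩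
  obtain ⟨C, hC, hD⟩ := exists_l1_dirichlet_le_rpow hm hB hδ.1
  have hd : 0 < α / 2 * (1 - α / 2) := mul_pos hδ.1 (by linarith [hδ.2])
  refine ⟨1 + C * (α / 2 * (1 - α / 2))⁻¹, by positivity, fun k c hc => ?_⟩
  obtain ⟨N, hN⟩ := Nat.exists_eq_succ_of_ne_zero (M_pos (m := m) k).ne'
  have hc1 : (1 : ℝ) ≤ c := by exact_mod_cast hc
  have h := l1_sum_smul_psiC_le (m := m) (fun s => (cesaroNumber (-α) (c + s) : ℂ)) N
  rw [← Nat.succ_eq_add_one, ← hN, l1_dirichlet_M hm, mul_one] at h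
  refine h.trans ?_
  rw [add_mul, one_mul]
  refine add_le_add ?_ ?_
  · rw [Complex.norm_real, Real.norm_of_nonneg (cesaroNumber_pos hα _).le]
    calc cesaroNumber (-α) (c + N) ≤ cesaroNumber (-α) c := cesaroNumber_antitone hα (by omega)
      _ ≤ ((c : ℝ) + 1) ^ (-α) := cesaroNumber_le hα c
      _ ≤ (c : ℝ) ^ (-α) :=
          Real.rpow_le_rpow_of_nonpos (by linarith) (by linarith) (by linarith [hα.1])
      _ ≤ (c : ℝ) ^ (-(α / 2)) := Real.rpow_le_rpow_of_exponent_le hc1 (by linarith [hα.1])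
  · calc _ ≤ ∑ s ∈ Finset.range N, C * ((c : ℝ) + s + 1) ^ (-1 - α / 2) := by
          refine Finset.sum_le_sum fun s _ => ?_
          have hp : (0 : ℝ) < (c : ℝ) + s + 1 := by positivity
          have h1 := cesaroNumber_sub_succ_le hα (c + s)
          push_cast at h1
          have h2 := hD (s + 1) (by omega)
          push_cast at h2
          have h3 : ((s : ℝ) + 1) ^ (α / 2) ≤ ((c : ℝ) + s + 1) ^ (α / 2) :=
            Real.rpow_le_rpow (by positivity) (by linarith) hδ.1.le
          rw [← Complex.ofReal_sub, Complex.norm_real, Real.norm_eq_abs, ← add_assoc]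
          calc _ ≤ ((c : ℝ) + s + 1) ^ (-1 - α) * (C * ((c : ℝ) + s + 1) ^ (α / 2)) :=
                mul_le_mul h1 (h2.trans (mul_le_mul_of_nonneg_left h3 hC.le)) (l1_nonneg _)
                  (by positivity)
            _ = C * (((c : ℝ) + s + 1) ^ (-1 - α) * ((c : ℝ) + s + 1) ^ (α / 2)) := by ring
            _ = C * ((c : ℝ) + s + 1) ^ (-1 - α / 2) := by
                rw [← Real.rpow_add hp]; congr 2; ring
      _ ≤ C * ((α / 2 * (1 - α / 2))⁻¹ * (c : ℝ) ^ (-(α / 2))) := by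
          rw [← Finset.mul_sum]
          exact mul_le_mul_of_nonneg_left (sum_rpow_tail_le hδ hc N) hC.le
      _ = _ := by ring

/-- In the Cesàro kernel the argument `n - i` decreases along a block. Reflection makes it increase
without changing the `L¹` norm, so that the shifted sums above apply. -/
theorem sum_reverse_psiC (hm : ∀ k, 2 ≤ m k) (k : ℕ) (a : ℕ → ℝ) :
    ∑ s ∈ Finset.range (M m k), (a (M m k - 1 - s) : ℂ) • psiC m s
      = psiC m (M m k - 1) * star (∑ s ∈ Finset.range (M m k), (a s : ℂ) • psiC m s) := by
  rw [← Finset.sum_range_reflect, star_sum, Finset.mul_sum]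
  refine Finset.sum_congr rfl fun s hs => ?_
  have hs := Finset.mem_range.1 hs
  have e : M m k - 1 - (M m k - 1 - s) = s := by omega
  ext x
  simp [e, psi_reverse hm k hs]

/-- The unnormalized kernels `∑_{i ≤ n} A_{n-i}^{-α} ψ_i` are bounded in `L¹`. -/
theorem exists_l1_cesaroKernel_le (hm : ∀ k, 2 ≤ m k) {B : ℕ} (hB : ∀ k, m k ≤ B) {α : ℝ}
    (hα : α ∈ Set.Ioo (0 : ℝ) 1) : ∃ C : ℝ, 0 < C ∧ ∀ n : ℕ,
      l1 (∑ i ∈ Finset.range (n + 1), (cesaroNumber (-α) (n - i) : ℂ) • psiC m i) ≤ C := by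
  obtain ⟨C, hC, hshift⟩ := exists_l1_sum_cesaro_shift_le hm hB hα
  set δ := α / 2 with hδdef
  have hδ : 0 < δ := by have := hα.1; positivity
  set F : ℕ → ℝ := fun n =>
    l1 (∑ i ∈ Finset.range (n + 1), (cesaroNumber (-α) (n - i) : ℂ) • psiC m i) with hF
  have hB0 : (0 : ℝ) < B := by exact_mod_cast (by linarith [hm 0, hB 0] : 0 < B)
  -- Removing the leading digit costs the full blocks below it, each of size `O((i+1)^{-δ})`.
  have hrec : ∀ k j i, j < m k → i < M m k →
      F (j * M m k + i) ≤ F i + B * C * ((i : ℝ) + 1) ^ (-δ) := by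
    intro k j i hj hi
    -- The kernel includes the index `n` itself, so the incomplete block has `i + 1` terms and may
    -- be full.
    have h := l1_sum_smul_psiC_split_le hm hj (i := i + 1) hi
      (fun s => (cesaroNumber (-α) (j * M m k + i - s) : ℂ)) (C := C * ((i : ℝ) + 1) ^ (-δ)) ?_
    · have e : ∀ s, j * M m k + i - (j * M m k + s) = i - s := fun s => by omega
      simp only [e, ← add_assoc] at h
      have h3 : (j : ℝ) ≤ B := by exact_mod_cast hj.le.trans (hB k)
      have h4 : 0 ≤ C * ((i : ℝ) + 1) ^ (-δ) := by positivity
      have h5 := mul_le_mul_of_nonneg_right h3 h4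
      simp only [hF]
      linarith
    · intro b hb
      -- The smallest argument of the Cesàro numbers in block `b`, attained at `s = M_k - 1`; it is
      -- at least `i + 1` because `b + 1 ≤ j`.
      set c := j * M m k + i - b * M m k - (M m k - 1) with hc
      have hle : (b + 1) * M m k ≤ j * M m k := Nat.mul_le_mul_right _ hb
      rw [add_mul, one_mul] at hle
      have hMp := M_pos (m := m) k
      have hci : i + 1 ≤ c := by omega
      have e : ∀ s ∈ Finset.range (M m k),
          (cesaroNumber (-α) (j * M m k + i - (b * M m k + s)) : ℂ) • psiC m s
            = ((fun t => cesaroNumber (-α) (c + t)) (M m k - 1 - s) : ℂ) • psiC m s := by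
        intro s hs
        have hs := Finset.mem_range.1 hs
        have : j * M m k + i - (b * M m k + s) = c + (M m k - 1 - s) := by omega
        rw [this]
      rw [Finset.sum_congr rfl e, sum_reverse_psiC hm k (fun t => cesaroNumber (-α) (c + t)),
        l1_mul_of_norm_eq_one (fun x => norm_psi _ x), l1_star]
      refine (hshift k c (by omega)).trans (mul_le_mul_of_nonneg_left ?_ hC.le)
      exact Real.rpow_le_rpow_of_nonpos (by positivity) (by exact_mod_cast hci) (by linarith)
  -- The next removal costs a quantity depending on the remainder, which may be small. Adding that
  -- cost to `F n` gives a potential that grows by at most `B C 2^{-δk}` at level `k`, since `n ≥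
  -- M_k ≥ 2^k` whenever the leading digit sits there.
  have hind : ∀ k n, n < M m k → F n + B * C * ((n : ℝ) + 1) ^ (-δ)
      ≤ 1 + B * C + B * C * ∑ j ∈ Finset.range k, ((2 : ℝ) ^ (-δ)) ^ j := by
    intro k
    induction k with
    | zero =>
      intro n hn
      simp [M] at hn; subst hn
      simp [hF, cesaroNumber_zero, l1_psiC]
    | succ k ih =>
      intro n hn
      rw [Finset.sum_range_succ]
      have hBC : 0 < B * C := by positivity
      have hpk : 0 < ((2 : ℝ) ^ (-δ)) ^ k := by positivity
      rcases lt_or_ge n (M m k) with h | h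
      · have := ih n h
        nlinarith
      · obtain ⟨j, i, hj, hi, rfl⟩ := exists_leading_digit hn
        have h1 := hrec k j i hj hi
        have h2 := ih i hi
        have h3 : (((j * M m k + i : ℕ) : ℝ) + 1) ^ (-δ) ≤ ((2 : ℝ) ^ (-δ)) ^ k := by
          rw [Real.rpow_pow_comm zero_le_two]
          refine Real.rpow_le_rpow_of_nonpos (by positivity) ?_ (by linarith)
          have := (two_pow_le_M hm k).trans h
          have : ((2 ^ k : ℕ) : ℝ) ≤ ((j * M m k + i : ℕ) : ℝ) := by exact_mod_cast this
          push_cast at this ⊢; linarith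
        have h4 := mul_le_mul_of_nonneg_left h3 hBC.le
        rw [mul_add]
        linarith
  have hr1 : (2 : ℝ) ^ (-δ) < 1 := Real.rpow_lt_one_of_one_lt_of_neg one_lt_two (by linarith)
  refine ⟨1 + B * C + B * C * (1 - (2 : ℝ) ^ (-δ))⁻¹, ?_, fun n => ?_⟩
  · have : 0 < 1 - (2 : ℝ) ^ (-δ) := by linarith
    positivity
  · have h := hind n n (lt_M_self hm n)
    have h1 : ∑ j ∈ Finset.range n, ((2 : ℝ) ^ (-δ)) ^ j ≤ (1 - (2 : ℝ) ^ (-δ))⁻¹ := by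
      rw [← tsum_geometric_of_lt_one (by positivity) hr1]
      exact (summable_geometric_of_lt_one (by positivity) hr1).sum_le_tsum _
        fun _ _ => by positivity
    have h2 : 0 ≤ B * C * ((n : ℝ) + 1) ^ (-δ) := by positivity
    have h3 := mul_le_mul_of_nonneg_left h1 (by positivity : 0 ≤ B * C)
    change F n ≤ _
    linarith

end Kernels

/-! ### The normalized Cesàro weights and their distance from one at low frequencies. -/

section CesaroWeights

variable {m : ℕ → ℕ} [∀ k, NeZero (m k)] {α : ℝ}

/-- The multiplier `A_{n-i}^{-α} / A_n^{-α}` of the one-dimensional Cesàro mean. -/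
noncomputable def cesaroWeight (α : ℝ) (n i : ℕ) : ℝ :=
  cesaroNumber (-α) (n - i) / cesaroNumber (-α) n

theorem cesaroWeight_zero (hα : α ∈ Set.Ioo (0 : ℝ) 1) (n : ℕ) : cesaroWeight α n 0 = 1 :=
  div_self (cesaroNumber_pos hα n).ne'

theorem inv_cesaroNumber_le (hα : α ∈ Set.Ioo (0 : ℝ) 1) {n : ℕ} (hn : 1 ≤ n) :
    (cesaroNumber (-α) n)⁻¹ ≤ (1 - α)⁻¹ * (n : ℝ) ^ α := by
  have hn0 : (0 : ℝ) < n := by exact_mod_cast hn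
  have h1 : 0 < 1 - α := by linarith [hα.2]
  have h2 := le_cesaroNumber hα hn
  have h3 : (1 - α)⁻¹ * (n : ℝ) ^ α = ((1 - α) * (n : ℝ) ^ (-α))⁻¹ := by
    rw [mul_inv, Real.rpow_neg hn0.le, inv_inv]
  rw [h3]
  exact inv_anti₀ (by positivity) h2

/-- The Cesàro kernels of order `-α` have `L¹` norm `O(n ^ α)`. -/
theorem exists_l1_cesaroWeight_le (hm : ∀ k, 2 ≤ m k) {B : ℕ} (hB : ∀ k, m k ≤ B)
    (hα : α ∈ Set.Ioo (0 : ℝ) 1) : ∃ C : ℝ, 0 < C ∧ ∀ n : ℕ, 1 ≤ n →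
      l1 (∑ i ∈ Finset.range (n + 1), (cesaroWeight α n i : ℂ) • psiC m i) ≤ C * (n : ℝ) ^ α := by
  obtain ⟨C, hC, h⟩ := exists_l1_cesaroKernel_le hm hB hα
  have h1 : 0 < 1 - α := by linarith [hα.2]
  refine ⟨C * (1 - α)⁻¹, by positivity, fun n hn => ?_⟩
  have e : ∑ i ∈ Finset.range (n + 1), (cesaroWeight α n i : ℂ) • psiC m i
      = ((cesaroNumber (-α) n)⁻¹ : ℂ) •
        ∑ i ∈ Finset.range (n + 1), (cesaroNumber (-α) (n - i) : ℂ) • psiC m i := by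
    rw [Finset.smul_sum]
    refine Finset.sum_congr rfl fun i _ => ?_
    rw [smul_smul, cesaroWeight]; push_cast; rw [div_eq_inv_mul]
  have hp := cesaroNumber_pos hα n
  rw [e, l1_smul, ← Complex.ofReal_inv, Complex.norm_real,
    Real.norm_of_nonneg (inv_nonneg.2 hp.le)]
  calc (cesaroNumber (-α) n)⁻¹ * _ ≤ ((1 - α)⁻¹ * (n : ℝ) ^ α) * C :=
        mul_le_mul (inv_cesaroNumber_le hα hn) (h n) (l1_nonneg _) (by positivity)
    _ = _ := by ring

/-- In the lower half of the frequencies `n - i ≥ n/2`, so the numerator is `O(n^{-1-α})`, and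
dividing by `A_n^{-α}` costs `O(n^α)`. The `4` bounds `2^{1+α}`. -/
theorem abs_cesaroWeight_sub_succ_le (hα : α ∈ Set.Ioo (0 : ℝ) 1) {n i : ℕ} (h : 2 * (i + 1) ≤ n) :
    |cesaroWeight α n i - cesaroWeight α n (i + 1)| ≤ 4 * (1 - α)⁻¹ / n := by
  have hn : 1 ≤ n := by omega
  have hn0 : (0 : ℝ) < n := by exact_mod_cast hn
  have h1 : 0 < 1 - α := by linarith [hα.2]
  obtain ⟨t, rfl⟩ : ∃ t, n = t + i + 1 := ⟨n - i - 1, by omega⟩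
  have e1 : t + i + 1 - i = t + 1 := by omega
  have e2 : t + i + 1 - (i + 1) = t := by omega
  set n := t + i + 1
  have ht : (n : ℝ) / 2 ≤ (t : ℝ) + 1 := by
    have : ((2 * (i + 1) : ℕ) : ℝ) ≤ ((t + i + 1 : ℕ) : ℝ) := by exact_mod_cast h
    simp only [n]; push_cast at this ⊢; linarith
  have hp := cesaroNumber_pos hα n
  rw [cesaroWeight, cesaroWeight, e1, e2, ← sub_div, abs_div, abs_of_pos hp, div_eq_mul_inv,
    abs_sub_comm]
  have h2 : ((t : ℝ) + 1) ^ (-1 - α) ≤ ((n : ℝ) / 2) ^ (-1 - α) :=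
    Real.rpow_le_rpow_of_nonpos (by positivity) ht (by linarith [hα.1])
  have h3 : ((n : ℝ) / 2) ^ (-1 - α) * (n : ℝ) ^ α = 2 ^ (1 + α) / n := by
    rw [Real.div_rpow hn0.le zero_le_two, div_mul_eq_mul_div, ← Real.rpow_add hn0,
      show -1 - α + α = -1 by ring, show -1 - α = -(1 + α) by ring, Real.rpow_neg zero_le_two,
      Real.rpow_neg_one]
    field_simp
  have h4 : (2 : ℝ) ^ (1 + α) ≤ 4 := by
    calc (2 : ℝ) ^ (1 + α) ≤ 2 ^ (2 : ℝ) :=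
          Real.rpow_le_rpow_of_exponent_le one_le_two (by linarith [hα.2])
      _ = 4 := by norm_num
  calc |cesaroNumber (-α) t - cesaroNumber (-α) (t + 1)| * (cesaroNumber (-α) n)⁻¹
      ≤ ((n : ℝ) / 2) ^ (-1 - α) * ((1 - α)⁻¹ * (n : ℝ) ^ α) :=
        mul_le_mul ((cesaroNumber_sub_succ_le hα t).trans h2) (inv_cesaroNumber_le hα hn)
          (inv_nonneg.2 hp.le) (by positivity)
    _ = (1 - α)⁻¹ * (((n : ℝ) / 2) ^ (-1 - α) * (n : ℝ) ^ α) := by ring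
    _ ≤ (1 - α)⁻¹ * (4 / n) := by rw [h3]; gcongr
    _ = _ := by ring

theorem abs_cesaroWeight_sub_one_le (hα : α ∈ Set.Ioo (0 : ℝ) 1) {n i : ℕ} (h : 2 * i ≤ n) :
    |cesaroWeight α n i - 1| ≤ i * (4 * (1 - α)⁻¹ / n) := by
  induction i with
  | zero => simp [cesaroWeight_zero hα]
  | succ i ih =>
    have h1 := ih (by omega)
    have h2 := abs_cesaroWeight_sub_succ_le hα h
    have h3 := abs_sub_le (cesaroWeight α n (i + 1)) (cesaroWeight α n i) 1
    rw [abs_sub_comm] at h2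
    push_cast
    linarith

/-- Summation by parts: the boundary term and the sum of differences each contribute about `N ·
(1/n)`, times `‖D_s‖₁ = O(N^α)`. The gain `N/n` later supplies the geometric weights. -/
theorem exists_l1_cesaroWeight_sub_one_le (hm : ∀ k, 2 ≤ m k) {B : ℕ} (hB : ∀ k, m k ≤ B)
    (hα : α ∈ Set.Ioo (0 : ℝ) 1) : ∃ C : ℝ, 0 < C ∧ ∀ n N : ℕ, 1 ≤ N → 2 * N ≤ n →
      l1 (∑ i ∈ Finset.range N, ((cesaroWeight α n i - 1 : ℝ) : ℂ) • psiC m i)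
        ≤ C * ((N : ℝ) ^ α * (N / n)) := by
  obtain ⟨C, hC, hD⟩ := exists_l1_dirichlet_le_rpow hm hB hα.1
  have h1 : 0 < 1 - α := by linarith [hα.2]
  refine ⟨8 * (1 - α)⁻¹ * C, by positivity, fun n N hN hNn => ?_⟩
  obtain ⟨N, rfl⟩ := Nat.exists_eq_succ_of_ne_zero (by omega : N ≠ 0)
  simp only [Nat.succ_eq_add_one] at *
  have hn0 : (0 : ℝ) < n := by exact_mod_cast (by omega : 0 < n)
  set q : ℝ := 4 * (1 - α)⁻¹ / n with hq
  have hq0 : 0 < q := by positivity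
  set R : ℝ := ((N + 1 : ℕ) : ℝ) ^ α with hR
  have hR0 : 0 < R := by positivity
  have hDR : ∀ s, s ≤ N → l1 (dirichlet m (s + 1)) ≤ C * R := fun s hs => by
    refine (hD (s + 1) (by omega)).trans (mul_le_mul_of_nonneg_left ?_ hC.le)
    exact Real.rpow_le_rpow (by positivity) (by exact_mod_cast (by omega)) hα.1.le
  refine (l1_sum_smul_psiC_le _ N).trans ?_
  have hfirst : ‖((cesaroWeight α n N - 1 : ℝ) : ℂ)‖ * l1 (dirichlet m (N + 1))
      ≤ (N * q) * (C * R) := by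
    rw [Complex.norm_real, Real.norm_eq_abs]
    exact mul_le_mul (abs_cesaroWeight_sub_one_le hα (by omega)) (hDR N le_rfl) (l1_nonneg _)
      (by positivity)
  have hsum : ∑ s ∈ Finset.range N, ‖((cesaroWeight α n s - 1 : ℝ) : ℂ)
        - ((cesaroWeight α n (s + 1) - 1 : ℝ) : ℂ)‖ * l1 (dirichlet m (s + 1))
      ≤ N * (q * (C * R)) := by
    calc _ ≤ ∑ s ∈ Finset.range N, q * (C * R) := by
          refine Finset.sum_le_sum fun s hs => ?_
          have hs := Finset.mem_range.1 hs
          rw [← Complex.ofReal_sub, Complex.norm_real, Real.norm_eq_abs, sub_sub_sub_cancel_right]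
          exact mul_le_mul (abs_cesaroWeight_sub_succ_le hα (by omega)) (hDR s hs.le)
            (l1_nonneg _) hq0.le
      _ = _ := by simp
  have hfin : 8 * (1 - α)⁻¹ * C * (R * (((N + 1 : ℕ) : ℝ) / n))
      = 2 * ((N + 1) * (q * (C * R))) := by
    rw [hq]; push_cast; ring
  rw [hfin]
  have : 0 < q * (C * R) := by positivity
  linarith

end CesaroWeights

/-! ### Fourier multipliers from a group action; the one-variable estimate. -/

section Actions

/-- A strongly continuous action of the Vilenkin group by linear contractions. -/
structure ContractiveAction (m : ℕ → ℕ) (V : Type*) [NormedAddCommGroup V] [NormedSpace ℂ V] where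
  act : VGroup m → V →L[ℂ] V
  act_add : ∀ u v f, act (u + v) f = act u (act v f)
  norm_act_le : ∀ u f, ‖act u f‖ ≤ ‖f‖
  continuous_act : ∀ f, Continuous fun u => act u f

variable {m : ℕ → ℕ} [∀ k, NeZero (m k)] {V W : Type*} [NormedAddCommGroup V] [NormedSpace ℂ V]
  [CompleteSpace V] [NormedAddCommGroup W] [NormedSpace ℂ W] [CompleteSpace W]

namespace ContractiveAction

variable (S : ContractiveAction m V)

/-- The integrand of a convolution. -/
noncomputable def orbit (K : C(VGroup m, ℂ)) (f : V) : C(VGroup m, V) :=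
  ⟨fun u => star (K u) • S.act u f, (K.continuous.star).smul (S.continuous_act f)⟩

theorem integrable_orbit (K : C(VGroup m, ℂ)) (f : V) :
    Integrable (fun u => star (K u) • S.act u f) (haar m) :=
  integrable_continuousMap (S.orbit K f)

/-- The convolution `f ↦ ∫ conj (K u) τ_u f du`. -/
noncomputable def conv (K : C(VGroup m, ℂ)) : V →L[ℂ] V :=
  LinearMap.mkContinuous
    { toFun := fun f => ∫ u, star (K u) • S.act u f ∂(haar m)
      map_add' := fun f g => by
        rw [← integral_add (S.integrable_orbit K f) (S.integrable_orbit K g)]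
        simp
      map_smul' := fun c f => by
        rw [RingHom.id_apply, ← integral_smul]
        simp [smul_comm c] }
    (l1 K) fun f => by
      rw [l1, ← integral_mul_const]
      refine norm_integral_le_of_norm_le
        ((integrable_continuousMap K).norm.mul_const _) (Eventually.of_forall fun u => ?_)
      rw [norm_smul, norm_star]
      exact mul_le_mul_of_nonneg_left (S.norm_act_le u f) (norm_nonneg _)

theorem conv_apply (K : C(VGroup m, ℂ)) (f : V) :
    S.conv K f = ∫ u, star (K u) • S.act u f ∂(haar m) := rfl

/-- Minkowski's inequality for the seminorm `‖Φ ·‖`, which need not be the norm of `V`: later `V` is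
`C` and `Φ` carries the `L^p` norm. -/
theorem norm_map_conv_le {Φ : V →L[ℂ] W} (hΦ : ∀ u f, ‖Φ (S.act u f)‖ ≤ ‖Φ f‖)
    (K : C(VGroup m, ℂ)) (f : V) : ‖Φ (S.conv K f)‖ ≤ l1 K * ‖Φ f‖ := by
  rw [conv_apply, ← Φ.integral_comp_comm (S.integrable_orbit K f), l1, ← integral_mul_const]
  refine norm_integral_le_of_norm_le
    ((integrable_continuousMap K).norm.mul_const _) (Eventually.of_forall fun u => ?_)
  rw [map_smul, norm_smul, norm_star]
  exact mul_le_mul_of_nonneg_left (hΦ u f) (norm_nonneg _)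

theorem conv_sum_smul (s : Finset ℕ) (a : ℕ → ℝ) (f : V) :
    S.conv (∑ i ∈ s, (a i : ℂ) • psiC m i) f = ∑ i ∈ s, (a i : ℂ) • S.conv (psiC m i) f := by
  simp only [conv_apply]
  simp_rw [← integral_smul]
  rw [← integral_finsetSum s
    (f := fun i u => (a i : ℂ) • star (psiC m i u) • S.act u f)
    fun i _ => (S.integrable_orbit (psiC m i) f).smul (a i : ℂ)]
  congr 1; ext u
  simp [star_sum, Finset.sum_smul, smul_smul]

/-- Substituting `v ↦ u + v` in the defining integral shows that convolution with `ψ_j` lands in the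
`ψ_j`-isotypic part of the action. -/
theorem act_conv_psiC (j : ℕ) (u : VGroup m) (f : V) :
    S.act u (S.conv (psiC m j) f) = psi m j u • S.conv (psiC m j) f := by
  have h : S.conv (psiC m j) f = star (psi m j u) • S.act u (S.conv (psiC m j) f) := by
    conv_lhs => rw [conv_apply, ← integral_add_left_eq_self _ u]
    rw [conv_apply, ← (S.act u).integral_comp_comm (S.integrable_orbit _ f), ← integral_smul]
    congr 1; ext v
    simp [psi_add, S.act_add, smul_smul]
  conv_rhs => rw [h, smul_smul, mul_comm, star_psi_mul_self, one_smul]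

theorem conv_psiC_conv_psiC (hm : ∀ k, 2 ≤ m k) (i j : ℕ) (f : V) :
    S.conv (psiC m i) (S.conv (psiC m j) f) = if i = j then S.conv (psiC m j) f else 0 := by
  rw [conv_apply]
  simp only [act_conv_psiC, smul_smul, psiC_apply]
  rw [integral_smul_const, integral_star_psi_mul_psi hm]
  split_ifs <;> simp

/-- The Fourier multiplier with weights `a i`, `i < N`. -/
noncomputable def multiplier (a : ℕ → ℝ) (N : ℕ) : V →L[ℂ] V :=
  S.conv (∑ i ∈ Finset.range N, (a i : ℂ) • psiC m i)

theorem multiplier_apply (a : ℕ → ℝ) (N : ℕ) (f : V) :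
    S.multiplier a N f = ∑ i ∈ Finset.range N, (a i : ℂ) • S.conv (psiC m i) f :=
  S.conv_sum_smul _ _ _

/-- The convolutions with the `ψ_i` are mutually annihilating idempotents, so weights multiply and
the shorter range survives. -/
theorem multiplier_comp (hm : ∀ k, 2 ≤ m k) (a b : ℕ → ℝ) {N N' : ℕ} (h : N ≤ N') (f : V) :
    S.multiplier a N' (S.multiplier b N f) = S.multiplier (fun i => a i * b i) N f := by
  simp only [multiplier_apply, map_sum, map_smul, conv_psiC_conv_psiC S hm]
  simp only [Finset.smul_sum, smul_ite, smul_zero]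
  refine Finset.sum_congr rfl fun j hj => ?_
  have hj' : j ∈ Finset.range N' := Finset.range_mono h hj
  rw [Finset.sum_ite_eq', if_pos hj', smul_smul]
  push_cast; rw [mul_comm]

/-- The partial sum of order `M_r`, that is, the averaging over `I_r`. -/
noncomputable def partialSum (r : ℕ) : V →L[ℂ] V := S.multiplier (fun _ => 1) (M m r)

theorem partialSum_eq (r : ℕ) : S.partialSum r = S.conv (dirichlet m (M m r)) := by
  simp [partialSum, multiplier, dirichlet]

theorem norm_map_partialSum_le (hm : ∀ k, 2 ≤ m k) {Φ : V →L[ℂ] W}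
    (hΦ : ∀ u f, ‖Φ (S.act u f)‖ ≤ ‖Φ f‖) (r : ℕ) (f : V) :
    ‖Φ (S.partialSum r f)‖ ≤ ‖Φ f‖ := by
  simpa [partialSum_eq, l1_dirichlet_M hm] using S.norm_map_conv_le hΦ (dirichlet m (M m r)) f

/-- The kernel `D_{M_r}` is nonnegative, has integral one and lives on `I_r`, so only translations
by `I_r` enter. -/
theorem norm_map_sub_partialSum_le (hm : ∀ k, 2 ≤ m k) {Φ : V →L[ℂ] W} {r : ℕ} {f : V} {w : ℝ}
    (hw : ∀ u ∈ I m r, ‖Φ (S.act u f - f)‖ ≤ w) : ‖Φ (S.partialSum r f - f)‖ ≤ w := by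
  set D := dirichlet m (M m r) with hD
  have hstar : ∀ u, star (D u) = D u := fun u => by
    rw [← coe_norm_dirichlet_M hm]; simp
  have e : S.partialSum r f - f = ∫ u, star (D u) • (S.act u f - f) ∂(haar m) := by
    simp only [smul_sub]
    rw [integral_sub (S.integrable_orbit D f), integral_smul_const, partialSum_eq, conv_apply]
    · have h1 : ∫ u, star (D u) ∂(haar m) = 1 := by
        simp only [hstar]; exact integral_dirichlet_M hm r
      rw [h1, one_smul]
    · exact (integrable_continuousMap (star D)).smul_const f
  have hint : Integrable (fun u => star (D u) • (S.act u f - f)) (haar m) := by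
    simp only [smul_sub]
    exact (S.integrable_orbit D f).sub ((integrable_continuousMap (star D)).smul_const f)
  rw [e, ← Φ.integral_comp_comm hint]
  have h1 : w = ∫ u, ‖D u‖ * w ∂(haar m) := by
    rw [integral_mul_const]
    change w = l1 D * w
    rw [l1_dirichlet_M hm, one_mul]
  rw [h1]
  refine norm_integral_le_of_norm_le
    ((integrable_continuousMap D).norm.mul_const _) (Eventually.of_forall fun u => ?_)
  rw [map_smul, norm_smul, norm_star]
  by_cases hu : u ∈ I m r
  · exact mul_le_mul_of_nonneg_left (hw u hu) (norm_nonneg _)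
  · rw [hD, dirichlet_M_apply hm]; simp [hu]

/-- The one-dimensional Cesàro mean of order `-α`. -/
noncomputable def cesaro (α : ℝ) (n : ℕ) : V →L[ℂ] V := S.multiplier (cesaroWeight α n) (n + 1)

theorem cesaro_partialSum_sub (hm : ∀ k, 2 ≤ m k) (α : ℝ) {n r : ℕ} (h : M m r ≤ n + 1) (f : V) :
    S.cesaro α n (S.partialSum r f) - S.partialSum r f
      = S.multiplier (fun i => cesaroWeight α n i - 1) (M m r) f := by
  rw [cesaro, partialSum, multiplier_comp S hm _ _ h]
  simp only [multiplier_apply, ← Finset.sum_sub_distrib, ← sub_smul]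
  simp

/-- Let `T_r` be the multiplier `w_i - 1` cut off at `M_r`. Since `T_{r+1} S_r = T_r`, the sum
telescopes to `T_κ - T_0`, and `T_0 = 0` because the weight at `0` is one. -/
theorem cesaro_partialSum_sub_eq_sum (hm : ∀ k, 2 ≤ m k) {α : ℝ} (hα : α ∈ Set.Ioo (0 : ℝ) 1)
    {n κ : ℕ} (h : M m κ ≤ n + 1) (f : V) :
    S.cesaro α n (S.partialSum κ f) - S.partialSum κ f
      = ∑ r ∈ Finset.range κ,
          S.multiplier (fun i => cesaroWeight α n i - 1) (M m (r + 1)) (f - S.partialSum r f) := by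
  induction κ with
  | zero =>
    rw [cesaro_partialSum_sub S hm α h]
    simp [multiplier_apply, M, cesaroWeight_zero hα]
  | succ κ ih =>
    have hle : M m κ ≤ M m (κ + 1) := M_monotone hm (Nat.le_succ κ)
    rw [Finset.sum_range_succ, ← ih (hle.trans h), cesaro_partialSum_sub S hm α h,
      cesaro_partialSum_sub S hm α (hle.trans h), map_sub]
    have : S.multiplier (fun i => cesaroWeight α n i - 1) (M m (κ + 1)) (S.partialSum κ f)
        = S.multiplier (fun i => cesaroWeight α n i - 1) (M m κ) f := by
      rw [partialSum, multiplier_comp S hm _ _ hle]; simp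
    rw [this]; abel

end ContractiveAction

/-- The part `f - S_κ f` meets the crude bound `n^α`, comparable to `M_κ^α`. The rest telescopes
over scales, each carrying the gain `M_{r+1}/n ≤ 2^{-(κ-r)}`. Placing `n` above `M_{κ+1}` rather
than `M_κ` ensures `2 M_{r+1} ≤ n` for all `r < κ`. -/
theorem exists_norm_cesaro_sub_le (hm : ∀ k, 2 ≤ m k) {B : ℕ} (hB : ∀ k, m k ≤ B) {α : ℝ}
    (hα : α ∈ Set.Ioo (0 : ℝ) 1) : ∃ C : ℝ, 0 < C ∧
      ∀ {V W : Type} [NormedAddCommGroup V] [NormedSpace ℂ V] [CompleteSpace V]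
        [NormedAddCommGroup W] [NormedSpace ℂ W] [CompleteSpace W] (S : ContractiveAction m V)
        (Φ : V →L[ℂ] W), (∀ u f, ‖Φ (S.act u f)‖ ≤ ‖Φ f‖) → ∀ (n κ : ℕ),
        M m (κ + 1) ≤ n → n < M m (κ + 2) → ∀ f : V,
        ‖Φ (S.cesaro α n f - f)‖ ≤ C * ∑ r ∈ Finset.range (κ + 1),
          (1 / 2 : ℝ) ^ (κ - r) * ((M m r : ℝ) ^ α * ‖Φ (f - S.partialSum r f)‖) := by
  obtain ⟨C₁, hC₁, h₁⟩ := exists_l1_cesaroWeight_le hm hB hα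
  obtain ⟨C₂, hC₂, h₂⟩ := exists_l1_cesaroWeight_sub_one_le hm hB hα
  have hB1 : (1 : ℝ) ≤ B := by exact_mod_cast (by linarith [hm 0, hB 0] : 1 ≤ B)
  have hB0 : (0 : ℝ) < B := by linarith
  have hBα : (B : ℝ) ^ α ≤ B := by
    simpa using Real.rpow_le_rpow_of_exponent_le hB1 hα.2.le
  have hMsucc : ∀ r, (M m (r + 1) : ℝ) ^ α ≤ B * (M m r : ℝ) ^ α := by
    intro r
    have : (M m (r + 1) : ℝ) ≤ B * M m r := by
      have : M m (r + 1) ≤ B * M m r := Nat.mul_le_mul_right _ (hB r)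
      exact_mod_cast this
    calc (M m (r + 1) : ℝ) ^ α ≤ (B * M m r : ℝ) ^ α :=
          Real.rpow_le_rpow (by positivity) this hα.1.le
      _ = (B : ℝ) ^ α * (M m r : ℝ) ^ α := Real.mul_rpow (by positivity) (by positivity)
      _ ≤ _ := by gcongr
  -- `B * B` comes from `n < M_{κ+2} ≤ B² M_κ`, the `1` from the identity in `σ - 1`, and the last
  -- `B` from passing from `M_{r+1}` to `M_r`.
  refine ⟨(C₁ * (B * B) + 1) + C₂ * B, by positivity, ?_⟩
  intro V W _ _ _ _ _ _ S Φ hΦ n κ hn hn' f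
  have hM1 : ∀ r, (1 : ℝ) ≤ (M m r : ℝ) ^ α := fun r =>
    Real.one_le_rpow (by exact_mod_cast M_pos r) hα.1.le
  have hn1 : 1 ≤ n := (M_pos (κ + 1)).trans_le hn
  have hn0 : (0 : ℝ) < n := by exact_mod_cast hn1
  have hMκ : M m κ ≤ n + 1 := (M_monotone hm (Nat.le_succ κ)).trans (hn.trans (Nat.le_succ n))
  have hdec : S.cesaro α n f - f
      = (S.cesaro α n (f - S.partialSum κ f) - (f - S.partialSum κ f))
        + ∑ r ∈ Finset.range κ, S.multiplier (fun i => cesaroWeight α n i - 1) (M m (r + 1))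
            (f - S.partialSum r f) := by
    rw [← S.cesaro_partialSum_sub_eq_sum hm hα hMκ, map_sub]; abel
  set g : ℕ → ℝ := fun r => ‖Φ (f - S.partialSum r f)‖ with hg
  have hg0 : ∀ r, 0 ≤ g r := fun r => norm_nonneg _
  have hmain : ‖Φ (S.cesaro α n (f - S.partialSum κ f) - (f - S.partialSum κ f))‖
      ≤ (C₁ * (B * B) + 1) * ((M m κ : ℝ) ^ α * g κ) := by
    rw [map_sub]
    refine (norm_sub_le _ _).trans ?_
    have ha := (S.norm_map_conv_le hΦ _ (f - S.partialSum κ f)).trans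
      (mul_le_mul_of_nonneg_right (h₁ n hn1) (hg0 κ))
    have hb : (n : ℝ) ^ α ≤ B * B * (M m κ : ℝ) ^ α := by
      calc (n : ℝ) ^ α ≤ (M m (κ + 2) : ℝ) ^ α :=
            Real.rpow_le_rpow hn0.le (by exact_mod_cast hn'.le) hα.1.le
        _ ≤ B * (M m (κ + 1) : ℝ) ^ α := hMsucc _
        _ ≤ B * (B * (M m κ : ℝ) ^ α) := by gcongr; exact hMsucc _
        _ = _ := by ring
    have hc : C₁ * (n : ℝ) ^ α * g κ ≤ C₁ * (B * B * (M m κ : ℝ) ^ α) * g κ := by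
      have := hg0 κ
      gcongr
    have hd : g κ ≤ (M m κ : ℝ) ^ α * g κ := le_mul_of_one_le_left (hg0 κ) (hM1 κ)
    calc _ ≤ C₁ * (n : ℝ) ^ α * g κ + g κ := add_le_add ha le_rfl
      _ ≤ C₁ * (B * B * (M m κ : ℝ) ^ α) * g κ + (M m κ : ℝ) ^ α * g κ := add_le_add hc hd
      _ = _ := by ring
  have hterm : ∀ r ∈ Finset.range κ,
      ‖Φ (S.multiplier (fun i => cesaroWeight α n i - 1) (M m (r + 1)) (f - S.partialSum r f))‖
        ≤ C₂ * B * ((1 / 2 : ℝ) ^ (κ - r) * ((M m r : ℝ) ^ α * g r)) := by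
    intro r hr
    have hr := Finset.mem_range.1 hr
    have hpow : 2 ^ (κ - r) * M m (r + 1) ≤ n := by
      refine (two_pow_mul_M_le hm (r + 1) (κ - r)).trans ?_
      rwa [show r + 1 + (κ - r) = κ + 1 by omega]
    have h2 : 2 * M m (r + 1) ≤ n := by
      refine le_trans (Nat.mul_le_mul_right _ ?_) hpow
      calc 2 = 2 ^ 1 := rfl
        _ ≤ 2 ^ (κ - r) := Nat.pow_le_pow_right (by norm_num) (by omega)
    have ha := (S.norm_map_conv_le hΦ _ (f - S.partialSum r f)).trans
      (mul_le_mul_of_nonneg_right (h₂ n (M m (r + 1)) (M_pos _) h2) (hg0 r))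
    have hb : (M m (r + 1) : ℝ) / n ≤ (1 / 2 : ℝ) ^ (κ - r) := by
      rw [div_le_iff₀ hn0, one_div, inv_pow, le_inv_mul_iff₀ (by positivity)]
      exact_mod_cast hpow
    refine ha.trans ?_
    calc _ ≤ C₂ * ((B * (M m r : ℝ) ^ α) * (1 / 2 : ℝ) ^ (κ - r)) * g r := by
          have := hg0 r
          gcongr
          exact hMsucc r
      _ = _ := by ring
  rw [hdec, map_add, map_sum]
  refine (norm_add_le _ _).trans ((add_le_add hmain ((norm_sum_le _ _).trans
    (Finset.sum_le_sum hterm))).trans ?_)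
  rw [← Finset.mul_sum, Finset.sum_range_succ, Nat.sub_self, pow_zero, one_mul]
  have hs : 0 ≤ ∑ r ∈ Finset.range κ, (1 / 2 : ℝ) ^ (κ - r) * ((M m r : ℝ) ^ α * g r) :=
    Finset.sum_nonneg fun r _ => by have := hg0 r; positivity
  have hk : 0 ≤ (M m κ : ℝ) ^ α * g κ := by have := hg0 κ; positivity
  change _ ≤ (C₁ * (B * B) + 1 + C₂ * B)
    * (∑ r ∈ Finset.range κ, (1 / 2 : ℝ) ^ (κ - r) * ((M m r : ℝ) ^ α * g r)
      + (M m κ : ℝ) ^ α * g κ)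
  generalize ∑ r ∈ Finset.range κ, (1 / 2 : ℝ) ^ (κ - r) * ((M m r : ℝ) ^ α * g r) = X at *
  generalize (M m κ : ℝ) ^ α * g κ = Y at *
  have e1 : 0 ≤ (C₁ * (B * B) + 1) * X := by positivity
  have e2 : 0 ≤ C₂ * B * Y := by positivity
  linarith

end Actions

/-! ### Geometrically weighted averages of null sequences. -/

section GeometricAverage

/-- The geometrically weighted sums `∑_{r ≤ κ} 2^{-(κ-r)} e_r`. -/
noncomputable def geomAverage (e : ℕ → ℝ) (κ : ℕ) : ℝ :=
  ∑ r ∈ Finset.range (κ + 1), (1 / 2 : ℝ) ^ (κ - r) * e r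

theorem geomAverage_const_le {c : ℝ} (hc : 0 ≤ c) (κ : ℕ) : geomAverage (fun _ => c) κ ≤ 2 * c := by
  have h : ∑ r ∈ Finset.range (κ + 1), (1 / 2 : ℝ) ^ (κ - r) ≤ 2 := by
    have := Finset.sum_range_reflect (fun r => (1 / 2 : ℝ) ^ r) (κ + 1)
    simp only [Nat.add_sub_cancel] at this
    rw [this]
    refine le_trans ?_ tsum_geometric_two.le
    exact summable_geometric_two.sum_le_tsum _ fun _ _ => by positivity
  rw [geomAverage, ← Finset.sum_mul]
  exact mul_le_mul_of_nonneg_right h hc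

theorem geomAverage_add (e e' : ℕ → ℝ) (κ : ℕ) :
    geomAverage (fun r => e r + e' r) κ = geomAverage e κ + geomAverage e' κ := by
  simp [geomAverage, mul_add, Finset.sum_add_distrib]

theorem geomAverage_nonneg {e : ℕ → ℝ} (he : ∀ r, 0 ≤ e r) (κ : ℕ) : 0 ≤ geomAverage e κ :=
  Finset.sum_nonneg fun r _ => mul_nonneg (by positivity) (he r)

/-- Reversing the sum gives `∑_j 2^{-j} e_{κ-j}`; dominated convergence applies with the majorant
`2^{-j} e_0`. -/
theorem tendsto_geomAverage {e : ℕ → ℝ} (he : ∀ r, 0 ≤ e r) (hanti : Antitone e)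
    (h0 : Tendsto e atTop (𝓝 0)) : Tendsto (geomAverage e) atTop (𝓝 0) := by
  set F : ℕ → ℕ → ℝ := fun κ j => if j < κ + 1 then (1 / 2 : ℝ) ^ j * e (κ - j) else 0 with hF
  have e1 : geomAverage e = fun κ => ∑' j, F κ j := by
    funext κ
    rw [tsum_eq_sum (s := Finset.range (κ + 1)) fun j hj => if_neg (by simpa using hj),
      geomAverage, ← Finset.sum_range_reflect]
    refine Finset.sum_congr rfl fun j hj => ?_
    have hj := Finset.mem_range.1 hj
    have : κ - (κ + 1 - 1 - j) = j := by omega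
    rw [this]; simp only [if_pos hj, Nat.add_sub_cancel]
  have h2 : Tendsto (fun κ => ∑' j, F κ j) atTop (𝓝 (∑' _ : ℕ, (0 : ℝ))) := by
    refine tendsto_tsum_of_dominated_convergence (bound := fun j => (1 / 2 : ℝ) ^ j * e 0)
      (summable_geometric_two.mul_right _) (fun j => ?_) (Eventually.of_forall fun κ j => ?_)
    · have h3 : Tendsto (fun κ : ℕ => (1 / 2 : ℝ) ^ j * e (κ - j)) atTop (𝓝 0) := by
        simpa using (h0.comp (tendsto_sub_atTop_nat j)).const_mul ((1 / 2 : ℝ) ^ j)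
      refine h3.congr' ?_
      filter_upwards [eventually_ge_atTop j] with κ hκ
      simp only [hF]; rw [if_pos (by omega)]
    · simp only [hF]
      split_ifs
      · rw [Real.norm_of_nonneg (mul_nonneg (by positivity) (he _))]
        exact mul_le_mul_of_nonneg_left (hanti (Nat.zero_le _)) (by positivity)
      · simpa using he 0
  rw [e1]; simpa using h2

end GeometricAverage

/-! ### The two-parameter estimate for commuting actions. -/

section TwoActions

variable {m : ℕ → ℕ} [∀ k, NeZero (m k)]

theorem ContractiveAction.conv_comm {V : Type*} [NormedAddCommGroup V] [NormedSpace ℂ V]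
    [CompleteSpace V] {S S' : ContractiveAction m V}
    (h : ∀ u v f, S.act u (S'.act v f) = S'.act v (S.act u f)) (K L : C(VGroup m, ℂ)) (f : V) :
    S.conv K (S'.conv L f) = S'.conv L (S.conv K f) := by
  have h1 : ∀ u, S.act u (S'.conv L f) = S'.conv L (S.act u f) := fun u => by
    rw [conv_apply, ← (S.act u).integral_comp_comm (S'.integrable_orbit L f), conv_apply]
    simp [h]
  rw [S.conv_apply, S.conv_apply, ← (S'.conv L).integral_comp_comm (S.integrable_orbit K f)]
  simp [h1]

/-- The two-parameter estimate for a pair of commuting actions. -/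
theorem exists_norm_cesaro_cesaro_sub_le (hm : ∀ k, 2 ≤ m k) {B : ℕ} (hB : ∀ k, m k ≤ B) {α β : ℝ}
    (hα : α ∈ Set.Ioo (0 : ℝ) 1) (hβ : β ∈ Set.Ioo (0 : ℝ) 1) : ∃ C : ℝ, 0 < C ∧
      ∀ {V W : Type} [NormedAddCommGroup V] [NormedSpace ℂ V] [CompleteSpace V]
        [NormedAddCommGroup W] [NormedSpace ℂ W] [CompleteSpace W] (S S' : ContractiveAction m V)
        (Φ : V →L[ℂ] W), (∀ u v f, S.act u (S'.act v f) = S'.act v (S.act u f)) →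
        (∀ u f, ‖Φ (S.act u f)‖ ≤ ‖Φ f‖) → (∀ u f, ‖Φ (S'.act u f)‖ ≤ ‖Φ f‖) →
        ∀ (n l κ ν : ℕ), M m (κ + 1) ≤ n → n < M m (κ + 2) → M m (ν + 1) ≤ l → l < M m (ν + 2) →
        ∀ (f : V) (e : ℕ → ℝ), (∀ r, 0 ≤ e r) → Antitone e →
        (∀ r ≤ max κ ν, ∀ u ∈ I m r, (M m r : ℝ) ^ (α + β) * ‖Φ (S.act u f - f)‖ ≤ e r) →
        (∀ r ≤ max κ ν, ∀ u ∈ I m r, (M m r : ℝ) ^ (α + β) * ‖Φ (S'.act u f - f)‖ ≤ e r) →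
        ‖Φ (S.cesaro α n (S'.cesaro β l f) - f)‖ ≤ C * (geomAverage e κ + geomAverage e ν) := by
  obtain ⟨C₁, hC₁, h₁⟩ := exists_norm_cesaro_sub_le hm hB hα
  obtain ⟨C₂, hC₂, h₂⟩ := exists_norm_cesaro_sub_le hm hB hβ
  refine ⟨4 * C₁ * C₂ + C₁ + C₂, by positivity, ?_⟩
  intro V W _ _ _ _ _ _ S S' Φ hcomm hΦ hΦ' n l κ ν hn hn' hl hl' f e he hanti hS hS'
  have hM0 : ∀ r, (0 : ℝ) < M m r := fun r => by exact_mod_cast M_pos r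
  have hM1 : ∀ r, (1 : ℝ) ≤ M m r := fun r => by exact_mod_cast M_pos r
  have hsum : ∀ r, (M m r : ℝ) ^ (α + β) = (M m r : ℝ) ^ α * (M m r : ℝ) ^ β := fun r =>
    Real.rpow_add (hM0 r) _ _
  have hE : ∀ r ≤ max κ ν, (M m r : ℝ) ^ (α + β) * ‖Φ (f - S.partialSum r f)‖ ≤ e r := by
    intro r hr
    rw [← le_div_iff₀' (Real.rpow_pos_of_pos (hM0 r) _), ← neg_sub, map_neg, norm_neg]
    exact S.norm_map_sub_partialSum_le hm fun u hu => by
      rw [le_div_iff₀' (Real.rpow_pos_of_pos (hM0 r) _)]; exact hS r hr u hu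
  have hE' : ∀ r ≤ max κ ν, (M m r : ℝ) ^ (α + β) * ‖Φ (f - S'.partialSum r f)‖ ≤ e r := by
    intro r hr
    rw [← le_div_iff₀' (Real.rpow_pos_of_pos (hM0 r) _), ← neg_sub, map_neg, norm_neg]
    exact S'.norm_map_sub_partialSum_le hm fun u hu => by
      rw [le_div_iff₀' (Real.rpow_pos_of_pos (hM0 r) _)]; exact hS' r hr u hu
  have hweak : ∀ {γ : ℝ} {r : ℕ} {x : ℝ}, γ ≤ α + β → 0 ≤ x →
      (M m r : ℝ) ^ (α + β) * x ≤ e r → (M m r : ℝ) ^ γ * x ≤ e r := fun hγ hx h =>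
    (mul_le_mul_of_nonneg_right (Real.rpow_le_rpow_of_exponent_le (hM1 _) hγ) hx).trans h
  have hα0 := hα.1
  have hβ0 := hβ.1
  have hT : ‖Φ (S.cesaro α n f - f)‖ ≤ C₁ * geomAverage e κ := by
    refine (h₁ S Φ hΦ n κ hn hn' f).trans (mul_le_mul_of_nonneg_left ?_ hC₁.le)
    refine Finset.sum_le_sum fun r hr => mul_le_mul_of_nonneg_left ?_ (by positivity)
    have hr := Finset.mem_range.1 hr
    exact hweak (by linarith) (norm_nonneg _) (hE r (le_max_of_le_left (by omega)))
  have hU : ‖Φ (S'.cesaro β l f - f)‖ ≤ C₂ * geomAverage e ν := by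
    refine (h₂ S' Φ hΦ' l ν hl hl' f).trans (mul_le_mul_of_nonneg_left ?_ hC₂.le)
    refine Finset.sum_le_sum fun r hr => mul_le_mul_of_nonneg_left ?_ (by positivity)
    have hr := Finset.mem_range.1 hr
    exact hweak (by linarith) (norm_nonneg _) (hE' r (le_max_of_le_right (by omega)))
  -- Replace the smaller of `M_r`, `M_t` by the larger and keep only the difference at the larger
  -- scale; the other factor, `1 - S` or `1 - S'`, has norm at most `2`. Monotonicity of `e` makes
  -- the bound independent of `t`.
  have hmixed : ∀ r ≤ κ, ∀ t ≤ ν, (M m r : ℝ) ^ α * ((M m t : ℝ) ^ β *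
      ‖Φ (f - S.partialSum r f - S'.partialSum t (f - S.partialSum r f))‖) ≤ 2 * e r := by
    intro r hr t ht
    rcases le_total t r with h | h
    · have hx : ‖Φ (f - S.partialSum r f - S'.partialSum t (f - S.partialSum r f))‖
          ≤ 2 * ‖Φ (f - S.partialSum r f)‖ := by
        rw [map_sub Φ (f - S.partialSum r f)]
        refine (norm_sub_le _ _).trans ?_
        have := S'.norm_map_partialSum_le hm hΦ' t (f - S.partialSum r f)
        linarith
      calc _ ≤ (M m r : ℝ) ^ α * ((M m r : ℝ) ^ β * (2 * ‖Φ (f - S.partialSum r f)‖)) := by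
            gcongr; exact M_monotone hm h
        _ = 2 * ((M m r : ℝ) ^ (α + β) * ‖Φ (f - S.partialSum r f)‖) := by rw [hsum]; ring
        _ ≤ 2 * e r := by gcongr; exact hE r (le_max_of_le_left hr)
    · have hcc : S'.partialSum t (S.partialSum r f) = S.partialSum r (S'.partialSum t f) :=
        (ContractiveAction.conv_comm hcomm _ _ f).symm
      have hx : ‖Φ (f - S.partialSum r f - S'.partialSum t (f - S.partialSum r f))‖
          ≤ 2 * ‖Φ (f - S'.partialSum t f)‖ := by
        have e1 : f - S.partialSum r f - S'.partialSum t (f - S.partialSum r f)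
            = (f - S'.partialSum t f) - S.partialSum r (f - S'.partialSum t f) := by
          rw [map_sub, map_sub, hcc]; abel
        rw [e1, map_sub Φ (f - S'.partialSum t f)]
        refine (norm_sub_le _ _).trans ?_
        have := S.norm_map_partialSum_le hm hΦ r (f - S'.partialSum t f)
        linarith
      calc _ ≤ (M m t : ℝ) ^ α * ((M m t : ℝ) ^ β * (2 * ‖Φ (f - S'.partialSum t f)‖)) := by
            gcongr; exact M_monotone hm h
        _ = 2 * ((M m t : ℝ) ^ (α + β) * ‖Φ (f - S'.partialSum t f)‖) := by rw [hsum]; ring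
        _ ≤ 2 * e t := by gcongr; exact hE' t (le_max_of_le_right ht)
        _ ≤ 2 * e r := by gcongr; exact hanti h
  -- The first-variable estimate is applied to `σ'f - f`. Since `S_r` commutes with `σ'`, the
  -- second-variable estimate then applies to `f - S_r f`. The `4` is the `2` of `hmixed` times the
  -- total mass `2` of the geometric weights.
  have hTU : ‖Φ (S.cesaro α n (S'.cesaro β l f - f) - (S'.cesaro β l f - f))‖
      ≤ 4 * C₁ * C₂ * geomAverage e κ := by
    refine (h₁ S Φ hΦ n κ hn hn' _).trans ?_
    have hstep : ∀ r ∈ Finset.range (κ + 1),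
        (1 / 2 : ℝ) ^ (κ - r) * ((M m r : ℝ) ^ α *
          ‖Φ (S'.cesaro β l f - f - S.partialSum r (S'.cesaro β l f - f))‖)
          ≤ (1 / 2 : ℝ) ^ (κ - r) * (4 * C₂ * e r) := by
      intro r hr
      have hr := Nat.lt_succ_iff.1 (Finset.mem_range.1 hr)
      refine mul_le_mul_of_nonneg_left ?_ (by positivity)
      have hcc : S.partialSum r (S'.cesaro β l f) = S'.cesaro β l (S.partialSum r f) :=
        ContractiveAction.conv_comm hcomm _ _ f
      have e1 : S'.cesaro β l f - f - S.partialSum r (S'.cesaro β l f - f)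
          = S'.cesaro β l (f - S.partialSum r f) - (f - S.partialSum r f) := by
        rw [map_sub, map_sub, hcc]; abel
      rw [e1]
      have h3 := h₂ S' Φ hΦ' l ν hl hl' (f - S.partialSum r f)
      calc _ ≤ (M m r : ℝ) ^ α * _ := mul_le_mul_of_nonneg_left h3 (by positivity)
        _ = C₂ * ∑ t ∈ Finset.range (ν + 1), (1 / 2 : ℝ) ^ (ν - t) * ((M m r : ℝ) ^ α *
              ((M m t : ℝ) ^ β *
              ‖Φ (f - S.partialSum r f - S'.partialSum t (f - S.partialSum r f))‖)) := by
            rw [mul_left_comm, Finset.mul_sum]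
            congr 1
            exact Finset.sum_congr rfl fun t _ => by ring
        _ ≤ C₂ * geomAverage (fun _ => 2 * e r) ν := by
            refine mul_le_mul_of_nonneg_left (Finset.sum_le_sum fun t ht => ?_) hC₂.le
            exact mul_le_mul_of_nonneg_left
              (hmixed r hr t (Nat.lt_succ_iff.1 (Finset.mem_range.1 ht))) (by positivity)
        _ ≤ C₂ * (2 * (2 * e r)) := mul_le_mul_of_nonneg_left
            (geomAverage_const_le (by linarith [he r]) ν) hC₂.le
        _ = _ := by ring
    calc _ ≤ C₁ * ∑ r ∈ Finset.range (κ + 1), (1 / 2 : ℝ) ^ (κ - r) * (4 * C₂ * e r) :=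
          mul_le_mul_of_nonneg_left (Finset.sum_le_sum hstep) hC₁.le
      _ = _ := by
          rw [geomAverage, Finset.mul_sum, Finset.mul_sum]
          exact Finset.sum_congr rfl fun r _ => by ring
  have hdec : S.cesaro α n (S'.cesaro β l f) - f
      = (S.cesaro α n (S'.cesaro β l f - f) - (S'.cesaro β l f - f))
        + (S.cesaro α n f - f) + (S'.cesaro β l f - f) := by
    rw [map_sub]; abel
  rw [hdec, map_add, map_add]
  refine (norm_add₃_le).trans ?_
  have hκ := geomAverage_nonneg he κ
  have hν := geomAverage_nonneg he ν
  have p1 : 0 ≤ C₂ * geomAverage e κ := by positivity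
  have p2 : 0 ≤ C₁ * geomAverage e ν := by positivity
  have p3 : 0 ≤ C₁ * C₂ * geomAverage e ν := by positivity
  linarith

end TwoActions

/-! ### Translations on `C(G_m × G_m)` and identification with the double Cesàro means. -/

section Translations

variable {m : ℕ → ℕ} [∀ k, NeZero (m k)]

/-- The action of `G_m` on `C(G_m × G_m)` by translations along a homomorphism. -/
noncomputable def translation (φ : VGroup m →+ VGroup m × VGroup m) (hφ : Continuous φ) :
    ContractiveAction m C(VGroup m × VGroup m, ℂ) where
  act u := LinearMap.mkContinuous
    { toFun := fun f => ⟨fun z => f (z + φ u), by fun_prop⟩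
      map_add' := fun f g => by ext; rfl
      map_smul' := fun c f => by ext; rfl } 1 fun f => by
      rw [one_mul]
      exact (ContinuousMap.norm_le _ (norm_nonneg f)).2 fun z => f.norm_coe_le_norm _
  act_add u v f := by
    ext z
    change f (z + φ (u + v)) = f (z + φ u + φ v)
    rw [φ.map_add, add_assoc]
  norm_act_le u f :=
    (ContinuousMap.norm_le _ (norm_nonneg f)).2 fun z => f.norm_coe_le_norm (z + φ u)
  continuous_act f :=
    -- Joint continuity curries to continuity into `C`, whose norm topology is the compact-open one
    -- because the group is compact.
    (ContinuousMap.curry ⟨fun q : VGroup m × (VGroup m × VGroup m) => f (q.2 + φ q.1),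
      by fun_prop⟩).continuous

variable (m) in
/-- Translations in the first variable. -/
noncomputable def translationFst : ContractiveAction m C(VGroup m × VGroup m, ℂ) :=
  translation (AddMonoidHom.inl _ _)
    (by fun_prop : Continuous fun u : VGroup m => (u, (0 : VGroup m)))

variable (m) in
/-- Translations in the second variable. -/
noncomputable def translationSnd : ContractiveAction m C(VGroup m × VGroup m, ℂ) :=
  translation (AddMonoidHom.inr _ _)
    (by fun_prop : Continuous fun u : VGroup m => ((0 : VGroup m), u))

theorem translationFst_act_apply (u : VGroup m) (f : C(VGroup m × VGroup m, ℂ))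
    (z : VGroup m × VGroup m) : (translationFst m).act u f z = f (z + (u, 0)) := rfl

theorem translationSnd_act_apply (u : VGroup m) (f : C(VGroup m × VGroup m, ℂ))
    (z : VGroup m × VGroup m) : (translationSnd m).act u f z = f (z + (0, u)) := rfl

theorem translation_act_comm (u v : VGroup m) (f : C(VGroup m × VGroup m, ℂ)) :
    (translationFst m).act u ((translationSnd m).act v f)
      = (translationSnd m).act v ((translationFst m).act u f) := by
  ext z
  simp only [translationFst_act_apply, translationSnd_act_apply]
  rw [add_right_comm]

theorem translationFst_conv_apply (K : C(VGroup m, ℂ)) (f : C(VGroup m × VGroup m, ℂ))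
    (z : VGroup m × VGroup m) :
    (translationFst m).conv K f z = ∫ u, star (K u) * f (z + (u, 0)) ∂(haar m) := by
  rw [ContractiveAction.conv_apply,
    ContinuousMap.integral_apply ((translationFst m).integrable_orbit K f)]
  rfl

theorem translationSnd_conv_apply (K : C(VGroup m, ℂ)) (f : C(VGroup m × VGroup m, ℂ))
    (z : VGroup m × VGroup m) :
    (translationSnd m).conv K f z = ∫ u, star (K u) * f (z + (0, u)) ∂(haar m) := by
  rw [ContractiveAction.conv_apply,
    ContinuousMap.integral_apply ((translationSnd m).integrable_orbit K f)]
  rfl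

theorem integrable_continuousMap_prod (f : C(VGroup m × VGroup m, ℂ)) :
    Integrable f (haar2 m) :=
  f.continuous.integrable_of_hasCompactSupport (HasCompactSupport.of_compactSpace f)

/-- The function is a joint eigenvector of both translation actions, hence determined by its value
at `0`, which is the Fourier coefficient by Fubini. -/
theorem conv_conv_psiC_apply (f : C(VGroup m × VGroup m, ℂ)) (i j : ℕ)
    (z : VGroup m × VGroup m) :
    (translationFst m).conv (psiC m i) ((translationSnd m).conv (psiC m j) f) z
      = doubleCoeff m f i j * psi m i z.1 * psi m j z.2 := by
  set g := (translationFst m).conv (psiC m i) ((translationSnd m).conv (psiC m j) f) with hg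
  have h1 : ∀ u w, g (w + (u, 0)) = psi m i u * g w := fun u w => by
    rw [← translationFst_act_apply, hg, ContractiveAction.act_conv_psiC]; rfl
  have h2 : ∀ u w, g (w + (0, u)) = psi m j u * g w := fun u w => by
    rw [← translationSnd_act_apply, hg, ContractiveAction.conv_comm translation_act_comm,
      ContractiveAction.act_conv_psiC]; rfl
  have h3 : g 0 = doubleCoeff m f i j := by
    have hint : Integrable (fun z : VGroup m × VGroup m =>
        f z * (starRingEnd ℂ) (psi m i z.1) * (starRingEnd ℂ) (psi m j z.2))
        ((haar m).prod (haar m)) :=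
      integrable_continuousMap_prod (m := m)
        ⟨fun z => f z * (starRingEnd ℂ) (psi m i z.1) * (starRingEnd ℂ) (psi m j z.2), by
          have := continuous_psi (m := m) i
          have := continuous_psi (m := m) j
          fun_prop⟩
    rw [doubleCoeff, haar2, integral_prod _ hint, hg, translationFst_conv_apply]
    refine integral_congr_ae (Eventually.of_forall fun u => ?_)
    simp only [translationSnd_conv_apply, ← integral_const_mul, psiC_apply]
    refine integral_congr_ae (Eventually.of_forall fun v => ?_)
    simp only [zero_add, Prod.mk_add_mk, add_zero, Complex.star_def]
    ring
  have h4 : z = 0 + (z.1, 0) + (0, z.2) := by ext <;> simp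
  conv_lhs => rw [h4, h2, h1, h3]
  ring

theorem cesaro_cesaro_apply (f : C(VGroup m × VGroup m, ℂ)) (α β : ℝ) (n l : ℕ)
    (z : VGroup m × VGroup m) :
    (translationFst m).cesaro α n ((translationSnd m).cesaro β l f) z
      = cesaroMean m (-α) (-β) n l f z := by
  simp only [ContractiveAction.cesaro, ContractiveAction.multiplier_apply, map_sum, map_smul,
    ContinuousMap.sum_apply, ContinuousMap.smul_apply, conv_conv_psiC_apply, cesaroMean,
    Finset.smul_sum, Finset.mul_sum, smul_eq_mul]
  rw [Finset.sum_comm]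
  refine Finset.sum_congr rfl fun i _ => Finset.sum_congr rfl fun j _ => ?_
  simp only [cesaroWeight]
  push_cast
  ring

end Translations

/-! ### The norms of `L^p` and `C` treated uniformly. -/

section Norms

variable {m : ℕ → ℕ} [∀ k, NeZero (m k)] {p : ℝ≥0∞} {f g : VGroup m × VGroup m → ℂ}

theorem memLp_continuousMap (p : ℝ≥0∞) (g : C(VGroup m × VGroup m, ℂ)) :
    MemLp g p (haar2 m) :=
  MemLp.of_bound g.continuous.aestronglyMeasurable ‖g‖
    (Eventually.of_forall g.norm_coe_le_norm)

theorem memL_continuousMap (p : ℝ≥0∞) (g : C(VGroup m × VGroup m, ℂ)) : MemL m p g := by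
  unfold MemL
  split_ifs
  · exact g.continuous
  · exact memLp_continuousMap p g

theorem MemL.memLp (hf : MemL m p f) : MemLp f p (haar2 m) := by
  unfold MemL at hf
  split_ifs at hf
  · exact memLp_continuousMap p ⟨f, hf⟩
  · exact hf

theorem MemL.sub (hf : MemL m p f) (hg : MemL m p g) : MemL m p (fun z => f z - g z) := by
  unfold MemL at *
  split_ifs at *
  · exact Continuous.sub hf hg
  · exact MemLp.sub hf hg

theorem measurePreserving_add_right_haar2 (w : VGroup m × VGroup m) :
    MeasurePreserving (fun z => z + w) (haar2 m) (haar2 m) := by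
  simp only [add_comm _ w]
  exact measurePreserving_add_left (haar2 m) w

theorem MemL.translate (hf : MemL m p f) (w : VGroup m × VGroup m) :
    MemL m p (fun z => f (z + w)) := by
  unfold MemL at *
  split_ifs at *
  · fun_prop
  · exact hf.comp_measurePreserving (measurePreserving_add_right_haar2 w)

theorem normL_translate (hf : MemL m p f) (w : VGroup m × VGroup m) :
    normL m p (fun z => f (z + w)) = normL m p f := by
  have h := hf.memLp.1
  unfold normL
  split_ifs
  · exact (Equiv.addRight w).iSup_comp (g := fun z => ‖f z‖ₑ)
  · exact eLpNorm_comp_measurePreserving h (measurePreserving_add_right_haar2 w)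

theorem normL_add_le (hp : 1 ≤ p) (hf : MemL m p f) (hg : MemL m p g) :
    normL m p (fun z => f z + g z) ≤ normL m p f + normL m p g := by
  have hf' := hf.memLp.1
  have hg' := hg.memLp.1
  unfold normL
  split_ifs
  · exact iSup_le fun z => (enorm_add_le _ _).trans
      (add_le_add (le_iSup (fun z => ‖f z‖ₑ) z) (le_iSup (fun z => ‖g z‖ₑ) z))
  · exact eLpNorm_add_le hf' hg' hp

theorem normL_sub_comm : normL m p (fun z => f z - g z) = normL m p (fun z => g z - f z) := by
  unfold normL
  split_ifs
  · simp only [enorm_sub_rev]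
  · exact eLpNorm_sub_comm f g p _

theorem normL_le_of_enorm_le {c : ℝ≥0∞} (hf : ∀ z, ‖f z‖ₑ ≤ c) : normL m p f ≤ c := by
  unfold normL
  split_ifs
  · exact iSup_le hf
  · simpa using eLpNorm_le_of_ae_enorm_bound (p := p) (μ := haar2 m) (Eventually.of_forall hf)

theorem normL_lt_top (hf : MemL m p f) : normL m p f < ∞ := by
  unfold normL
  split_ifs with h
  · unfold MemL at hf
    rw [if_pos h] at hf
    refine lt_of_le_of_lt (iSup_le fun z => ?_) (enorm_lt_top (x := (⟨f, hf⟩ : C(_, ℂ))))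
    exact ContinuousMap.enorm_eq_iSup_enorm (f := (⟨f, hf⟩ : C(_, ℂ))) ▸
      le_iSup (fun z => ‖f z‖ₑ) z
  · exact hf.memLp.2

theorem eLpNorm_one_le_normL (hp : 1 ≤ p) (hf : MemL m p f) :
    eLpNorm f 1 (haar2 m) ≤ normL m p f := by
  refine (eLpNorm_le_eLpNorm_of_exponent_le hp hf.memLp.1).trans ?_
  unfold normL
  split_ifs with h
  · rw [h, eLpNorm_exponent_top]
    exact eLpNormEssSup_le_of_ae_enorm_bound
      (Eventually.of_forall fun z => le_iSup (fun z => ‖f z‖ₑ) z)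
  · exact le_rfl

theorem prod_add_mk (z : VGroup m × VGroup m) (u v : VGroup m) :
    z + (u, v) = (z.1 + u, z.2 + v) := rfl

theorem modulus_lt_top (hp : 1 ≤ p) (hf : MemL m p f) (r : ℕ) : modulus m p f r < ∞ := by
  have h := normL_lt_top hf
  refine lt_of_le_of_lt (iSup₂_le fun u _ => iSup₂_le fun v _ => ?_) (ENNReal.add_lt_top.2 ⟨h, h⟩)
  have h1 := normL_add_le hp (hf.translate (-u, -v)) ((memL_continuousMap p 0).sub hf)
  rw [normL_translate hf, normL_sub_comm] at h1
  simpa only [ContinuousMap.zero_apply, zero_sub, sub_zero, ← sub_eq_add_neg, prod_add_mk] using h1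

theorem exists_continuousMap_normL_sub_le (hf : MemL m p f) {ε : ℝ≥0∞} (hε : ε ≠ 0) :
    ∃ g : C(VGroup m × VGroup m, ℂ), normL m p (fun z => f z - g z) ≤ ε := by
  unfold MemL at hf
  split_ifs at hf with h
  · exact ⟨⟨f, hf⟩, by simp [normL, h]⟩
  · obtain ⟨g, hg, -⟩ := hf.exists_boundedContinuous_eLpNorm_sub_le h hε
    refine ⟨g.toContinuousMap, ?_⟩
    rw [normL, if_neg h]
    exact hg

/-- The norm `normL`, restricted to continuous functions, is the norm of a Banach space into which
these functions map continuously. -/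
theorem exists_clm_enorm_eq_normL (hp : 1 ≤ p) : ∃ (W : Type) (_ : NormedAddCommGroup W)
    (_ : NormedSpace ℂ W) (_ : CompleteSpace W) (Φ : C(VGroup m × VGroup m, ℂ) →L[ℂ] W),
    ∀ g, ‖Φ g‖ₑ = normL m p g := by
  by_cases h : p = ∞
  · refine ⟨C(VGroup m × VGroup m, ℂ), inferInstance, inferInstance, inferInstance,
      ContinuousLinearMap.id ℂ _, fun g => ?_⟩
    rw [normL, if_pos h]
    exact ContinuousMap.enorm_eq_iSup_enorm g
  · have : Fact (1 ≤ p) := ⟨hp⟩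
    refine ⟨Lp ℂ p (haar2 m), inferInstance, inferInstance, inferInstance,
      ContinuousMap.toLp p (haar2 m) ℂ, fun g => ?_⟩
    rw [normL, if_neg h, Lp.enorm_def]
    exact eLpNorm_congr_ae (ContinuousMap.coeFn_toLp (haar2 m) g)

end Norms

/-! ### From continuous functions to all of `L^p`, and the quantitative estimate. -/

section CesaroMeans

variable {m : ℕ → ℕ} [∀ k, NeZero (m k)] {p : ℝ≥0∞} {f g : VGroup m × VGroup m → ℂ}

theorem continuous_cesaroMean (a b : ℝ) (n l : ℕ) (f : VGroup m × VGroup m → ℂ) :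
    Continuous (cesaroMean m a b n l f) := by
  have := fun i => continuous_psi (m := m) i
  unfold cesaroMean
  fun_prop

theorem norm_star_psi_mul (i j : ℕ) (z : VGroup m × VGroup m) (c : ℂ) :
    ‖c * (starRingEnd ℂ) (psi m i z.1) * (starRingEnd ℂ) (psi m j z.2)‖ = ‖c‖ := by
  simp [norm_psi]

theorem integrable_doubleCoeff (hf : Integrable f (haar2 m)) (i j : ℕ) :
    Integrable (fun z => f z * (starRingEnd ℂ) (psi m i z.1) * (starRingEnd ℂ) (psi m j z.2))
      (haar2 m) := by
  have := fun i => continuous_psi (m := m) i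
  refine hf.mono ((hf.1.mul ?_).mul ?_) (Eventually.of_forall fun z =>
    (norm_star_psi_mul i j z _).le)
  · exact (by fun_prop : Continuous fun z : VGroup m × VGroup m =>
      (starRingEnd ℂ) (psi m i z.1)).aestronglyMeasurable
  · exact (by fun_prop : Continuous fun z : VGroup m × VGroup m =>
      (starRingEnd ℂ) (psi m j z.2)).aestronglyMeasurable

theorem doubleCoeff_sub (hf : Integrable f (haar2 m)) (hg : Integrable g (haar2 m)) (i j : ℕ) :
    doubleCoeff m (fun z => f z - g z) i j = doubleCoeff m f i j - doubleCoeff m g i j := by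
  rw [doubleCoeff, doubleCoeff, doubleCoeff,
    ← integral_sub (integrable_doubleCoeff hf i j) (integrable_doubleCoeff hg i j)]
  simp only [sub_mul]

theorem cesaroMean_sub (hf : Integrable f (haar2 m)) (hg : Integrable g (haar2 m)) (a b : ℝ)
    (n l : ℕ) (z : VGroup m × VGroup m) :
    cesaroMean m a b n l (fun z => f z - g z) z
      = cesaroMean m a b n l f z - cesaroMean m a b n l g z := by
  simp only [cesaroMean, doubleCoeff_sub hf hg, ← mul_sub, ← Finset.sum_sub_distrib, ← sub_mul]

theorem MemL.integrable (hp : 1 ≤ p) (hf : MemL m p f) : Integrable f (haar2 m) :=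
  hf.memLp.integrable hp

theorem enorm_doubleCoeff_le (hp : 1 ≤ p) (hf : MemL m p f) (i j : ℕ) :
    ‖doubleCoeff m f i j‖ₑ ≤ normL m p f := by
  refine le_trans ?_ (eLpNorm_one_le_normL hp hf)
  rw [eLpNorm_one_eq_lintegral_enorm]
  refine (enorm_integral_le_lintegral_enorm _).trans (lintegral_mono fun z => ?_)
  rw [enorm_le_iff_norm_le, norm_star_psi_mul]

/-- A crude bound by the sum of the absolute weights. It may depend badly on `n` and `l`, since it
is only used for approximation with both fixed. -/
theorem exists_normL_cesaroMean_le (m : ℕ → ℕ) [∀ k, NeZero (m k)] (a b : ℝ) (n l : ℕ) :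
    ∃ K : ℝ, 0 ≤ K ∧ ∀ {p : ℝ≥0∞} {f : VGroup m × VGroup m → ℂ}, 1 ≤ p → MemL m p f →
      normL m p (cesaroMean m a b n l f) ≤ ENNReal.ofReal K * normL m p f := by
  set c : ℕ → ℕ → ℂ := fun i j => 1 / ((cesaroNumber a n : ℂ) * (cesaroNumber b l : ℂ)) *
    ((cesaroNumber a (n - i) : ℂ) * (cesaroNumber b (l - j) : ℂ)) with hc
  refine ⟨∑ i ∈ Finset.range (n + 1), ∑ j ∈ Finset.range (l + 1), ‖c i j‖, by positivity, ?_⟩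
  intro p f hp hf
  refine normL_le_of_enorm_le fun z => ?_
  have e : cesaroMean m a b n l f z = ∑ i ∈ Finset.range (n + 1), ∑ j ∈ Finset.range (l + 1),
      c i j * (doubleCoeff m f i j * psi m i z.1 * psi m j z.2) := by
    simp only [cesaroMean, Finset.mul_sum, hc]
    refine Finset.sum_congr rfl fun i _ => Finset.sum_congr rfl fun j _ => ?_
    ring
  rw [e, ENNReal.ofReal_sum_of_nonneg fun i _ => by positivity, Finset.sum_mul]
  refine (enorm_sum_le _ _).trans (Finset.sum_le_sum fun i _ => ?_)
  rw [ENNReal.ofReal_sum_of_nonneg fun i _ => by positivity, Finset.sum_mul]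
  refine (enorm_sum_le _ _).trans (Finset.sum_le_sum fun j _ => ?_)
  rw [enorm_mul, ← ofReal_norm (c i j)]
  gcongr
  refine le_trans (le_of_eq ?_) (enorm_doubleCoeff_le hp hf i j)
  rw [← ofReal_norm, ← ofReal_norm, norm_mul, norm_mul, norm_psi, norm_psi,
    mul_one, mul_one]

/-- The abstract estimate for the two translation actions. Only the scales `r ≤ max κ ν` are
constrained, so the hypothesis survives a small perturbation of the function. -/
theorem exists_normL_cesaroMean_continuousMap_sub_le (hm : ∀ k, 2 ≤ m k) {B : ℕ}
    (hB : ∀ k, m k ≤ B) {α β : ℝ} (hα : α ∈ Set.Ioo (0 : ℝ) 1) (hβ : β ∈ Set.Ioo (0 : ℝ) 1) :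
    ∃ C : ℝ, 0 < C ∧ ∀ {p : ℝ≥0∞}, 1 ≤ p → ∀ (n l κ ν : ℕ),
      M m (κ + 1) ≤ n → n < M m (κ + 2) → M m (ν + 1) ≤ l → l < M m (ν + 2) →
      ∀ (g : C(VGroup m × VGroup m, ℂ)) (e : ℕ → ℝ), (∀ r, 0 ≤ e r) → Antitone e →
      (∀ r ≤ max κ ν, ∀ u ∈ I m r, ∀ v ∈ I m r, normL m p (fun z => g (z + (u, v)) - g z)
        ≤ ENNReal.ofReal (e r / (M m r : ℝ) ^ (α + β))) →
      normL m p (fun z => cesaroMean m (-α) (-β) n l g z - g z)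
        ≤ ENNReal.ofReal (C * (geomAverage e κ + geomAverage e ν)) := by
  obtain ⟨C, hC, h⟩ := exists_norm_cesaro_cesaro_sub_le hm hB hα hβ
  refine ⟨C, hC, ?_⟩
  intro p hp n l κ ν hn hn' hl hl' g e he hanti hω
  obtain ⟨W, _, _, _, Φ, hΦ⟩ := exists_clm_enorm_eq_normL (m := m) hp
  have hnorm : ∀ g g' : C(VGroup m × VGroup m, ℂ), normL m p g = normL m p g' →
      ‖Φ g‖ ≤ ‖Φ g'‖ := fun g g' h => by
    rw [← enorm_le_iff_norm_le, hΦ, hΦ, h]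
  have hmod : ∀ (r : ℕ) (g' : C(VGroup m × VGroup m, ℂ)),
      normL m p g' ≤ ENNReal.ofReal (e r / (M m r : ℝ) ^ (α + β)) →
      (M m r : ℝ) ^ (α + β) * ‖Φ g'‖ ≤ e r := by
    intro r g' hg'
    have hM : (0 : ℝ) < (M m r : ℝ) ^ (α + β) :=
      Real.rpow_pos_of_pos (by exact_mod_cast M_pos r) _
    rw [← le_div_iff₀' hM]
    rw [← hΦ, ← ofReal_norm] at hg'
    exact (ENNReal.ofReal_le_ofReal_iff (div_nonneg (he r) hM.le)).1 hg'
  have hmain := h (translationFst m) (translationSnd m) Φ translation_act_comm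
    (fun u g => hnorm _ _ (normL_translate (memL_continuousMap p g) (u, 0)))
    (fun u g => hnorm _ _ (normL_translate (memL_continuousMap p g) (0, u)))
    n l κ ν hn hn' hl hl' g e he hanti
    (fun r hr u hu => hmod r _ (hω r hr u hu 0 fun _ _ => rfl))
    (fun r hr u hu => hmod r _ (hω r hr 0 (fun _ _ => rfl) u hu))
  have hfun : (fun z => cesaroMean m (-α) (-β) n l g z - g z)
      = ((translationFst m).cesaro α n ((translationSnd m).cesaro β l g) - g :
        C(VGroup m × VGroup m, ℂ)) := by
    funext z
    rw [ContinuousMap.sub_apply, cesaro_cesaro_apply]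
  rw [hfun, ← hΦ, ← ofReal_norm]
  exact ENNReal.ofReal_le_ofReal hmain

theorem normL_translate_sub_le (hp : 1 ≤ p) (hf : MemL m p f) (hg : MemL m p g)
    (w : VGroup m × VGroup m) : normL m p (fun z => g (z + w) - g z)
      ≤ 2 * normL m p (fun z => f z - g z) + normL m p (fun z => f (z + w) - f z) := by
  have h1 := normL_add_le hp ((hg.sub hf).translate w)
    (((hf.translate w).sub hf).sub (hg.sub hf))
  have h2 : normL m p (fun z => (f (z + w) - f z) - (g z - f z))
      ≤ normL m p (fun z => f (z + w) - f z) + normL m p (fun z => f z - g z) := by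
    have := normL_add_le hp ((hf.translate w).sub hf) (hf.sub hg)
    refine le_trans (le_of_eq ?_) this
    congr 1; funext z; ring
  rw [normL_translate (hg.sub hf) w, normL_sub_comm (f := g)] at h1
  have e : (fun z => g (z + w) - g z)
      = fun z => (g (z + w) - f (z + w)) + ((f (z + w) - f z) - (g z - f z)) := by
    funext z; ring
  rw [e]
  refine h1.trans ((add_le_add le_rfl h2).trans (le_of_eq ?_))
  ring

/-- The modulus is defined with `f(· - u, · - v)` and the actions with `+`; `I_r` is symmetric. -/
theorem normL_translate_sub_le_modulus (f : VGroup m × VGroup m → ℂ) {r : ℕ} {u v : VGroup m}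
    (hu : u ∈ I m r) (hv : v ∈ I m r) :
    normL m p (fun z => f (z + (u, v)) - f z) ≤ modulus m p f r := by
  have hneg : ∀ x ∈ I m r, -x ∈ I m r := fun x hx k hk => by
    rw [Pi.neg_apply, hx k hk, neg_zero]
  have h : normL m p (fun z => f (z.1 - -u, z.2 - -v) - f z) ≤ modulus m p f r :=
    le_iSup₂_of_le (-u) (hneg u hu) (le_iSup₂_of_le (-v) (hneg v hv) le_rfl)
  simpa only [sub_neg_eq_add, prod_add_mk] using h

/-- A quantitative estimate of `‖σ_{n,l}^{-α,-β} f - f‖_p` by the modulus of continuity. -/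
theorem exists_normL_cesaroMean_sub_le (hm : ∀ k, 2 ≤ m k) {B : ℕ}
    (hB : ∀ k, m k ≤ B) {α β : ℝ} (hα : α ∈ Set.Ioo (0 : ℝ) 1) (hβ : β ∈ Set.Ioo (0 : ℝ) 1) :
    ∃ C : ℝ, 0 < C ∧ ∀ {p : ℝ≥0∞}, 1 ≤ p → ∀ (n l κ ν : ℕ),
      M m (κ + 1) ≤ n → n < M m (κ + 2) → M m (ν + 1) ≤ l → l < M m (ν + 2) →
      ∀ (f : VGroup m × VGroup m → ℂ), MemL m p f → ∀ (e : ℕ → ℝ), (∀ r, 0 ≤ e r) → Antitone e →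
      (∀ r, modulus m p f r ≤ ENNReal.ofReal (e r / (M m r : ℝ) ^ (α + β))) →
      normL m p (fun z => cesaroMean m (-α) (-β) n l f z - f z)
        ≤ ENNReal.ofReal (C * (geomAverage e κ + geomAverage e ν)) := by
  obtain ⟨C, hC, h⟩ := exists_normL_cesaroMean_continuousMap_sub_le hm hB hα hβ
  refine ⟨C, hC, ?_⟩
  intro p hp n l κ ν hn hn' hl hl' f hf e he hanti hω
  obtain ⟨K, hK, hbound⟩ := exists_normL_cesaroMean_le m (-α) (-β) n l
  -- The largest weight among the finitely many scales involved: an error `2η` in the modulus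
  -- becomes at most `2ηQ` in `e`.
  set Q : ℝ := (M m (max κ ν) : ℝ) ^ (α + β) with hQ
  have hQ0 : 0 < Q := Real.rpow_pos_of_pos (by exact_mod_cast M_pos _) _
  set A : ℝ := C * (geomAverage e κ + geomAverage e ν) with hA
  have hA0 : 0 ≤ A :=
    mul_nonneg hC.le (add_nonneg (geomAverage_nonneg he κ) (geomAverage_nonneg he ν))
  -- Here `η` is the approximation error; `K` and `Q` depend on `n`, `l` but not on `η`, so letting
  -- `η → 0` removes every extra term. The `8` comes from two geometric averages of the constant
  -- `2ηQ`, each at most `4ηQ`.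
  have key : ∀ η : ℝ, 0 < η → normL m p (fun z => cesaroMean m (-α) (-β) n l f z - f z)
      ≤ ENNReal.ofReal (K * η + (A + C * (8 * η * Q)) + η) := by
    intro η hη
    obtain ⟨g, hg⟩ := exists_continuousMap_normL_sub_le hf (ENNReal.ofReal_pos.2 hη).ne'
    have hgL := memL_continuousMap p g
    have hfg := hf.sub hgL
    have hgmod : ∀ r ≤ max κ ν, ∀ u ∈ I m r, ∀ v ∈ I m r,
        normL m p (fun z => g (z + (u, v)) - g z)
          ≤ ENNReal.ofReal ((e r + 2 * η * Q) / (M m r : ℝ) ^ (α + β)) := by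
      intro r hr u hu v hv
      have hMr : (0 : ℝ) < M m r := by exact_mod_cast M_pos r
      have hR : (0 : ℝ) < (M m r : ℝ) ^ (α + β) := Real.rpow_pos_of_pos hMr _
      have hRQ : (M m r : ℝ) ^ (α + β) ≤ Q :=
        Real.rpow_le_rpow hMr.le (by exact_mod_cast M_monotone hm hr) (by linarith [hα.1, hβ.1])
      refine (normL_translate_sub_le hp hf hgL (u, v)).trans ?_
      refine (add_le_add (mul_le_mul_right hg 2)
        ((normL_translate_sub_le_modulus f hu hv).trans (hω r))).trans ?_
      have e2 : (2 : ℝ≥0∞) = ENNReal.ofReal 2 := by simp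
      rw [e2, ← ENNReal.ofReal_mul zero_le_two,
        ← ENNReal.ofReal_add (by positivity) (div_nonneg (he r) hR.le)]
      refine ENNReal.ofReal_le_ofReal ?_
      rw [add_div, add_comm]
      gcongr
      rw [le_div_iff₀ hR]
      gcongr
    have h1 := h hp n l κ ν hn hn' hl hl' g (fun r => e r + 2 * η * Q)
      (fun r => by have := he r; positivity) (fun r t hrt => by simpa using hanti hrt) hgmod
    have h2 : normL m p (fun z => cesaroMean m (-α) (-β) n l g z - g z)
        ≤ ENNReal.ofReal (A + C * (8 * η * Q)) := by
      refine h1.trans (ENNReal.ofReal_le_ofReal ?_)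
      rw [geomAverage_add, geomAverage_add, hA, ← mul_add]
      have hk := geomAverage_const_le (c := 2 * η * Q) (by positivity) κ
      have hv := geomAverage_const_le (c := 2 * η * Q) (by positivity) ν
      refine mul_le_mul_of_nonneg_left ?_ hC.le
      linarith
    have h3 : normL m p (fun z => cesaroMean m (-α) (-β) n l (fun z => f z - g z) z)
        ≤ ENNReal.ofReal (K * η) := by
      rw [ENNReal.ofReal_mul hK]
      exact (hbound hp hfg).trans (mul_le_mul_right hg _)
    have hc : ∀ f' : VGroup m × VGroup m → ℂ, MemL m p (cesaroMean m (-α) (-β) n l f') :=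
      fun f' => memL_continuousMap p ⟨_, continuous_cesaroMean _ _ _ _ f'⟩
    have e1 : (fun z => cesaroMean m (-α) (-β) n l f z - f z)
        = fun z => cesaroMean m (-α) (-β) n l (fun z => f z - g z) z
          + ((cesaroMean m (-α) (-β) n l g z - g z) - (f z - g z)) := by
      funext z
      rw [cesaroMean_sub (hf.integrable hp) (hgL.integrable hp)]; ring
    have h4 : normL m p (fun z => (cesaroMean m (-α) (-β) n l g z - g z) - (f z - g z))
        ≤ ENNReal.ofReal (A + C * (8 * η * Q)) + ENNReal.ofReal η := by
      have h5 := normL_add_le hp ((hc g).sub hgL) (hgL.sub hf)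
      rw [normL_sub_comm (f := g)] at h5
      refine le_trans (le_of_eq ?_) (h5.trans (add_le_add h2 hg))
      congr 1; funext z; ring
    rw [e1, ENNReal.ofReal_add (by positivity) hη.le,
      ENNReal.ofReal_add (by positivity) (by positivity), add_assoc]
    exact (normL_add_le hp (hc _) (((hc g).sub hgL).sub hfg)).trans (add_le_add h3 h4)
  have hlim : Tendsto (fun η : ℝ => ENNReal.ofReal (K * η + (A + C * (8 * η * Q)) + η))
      (𝓝[>] 0) (𝓝 (ENNReal.ofReal A)) := by
    have hcont : Continuous fun η : ℝ => ENNReal.ofReal (K * η + (A + C * (8 * η * Q)) + η) :=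
      ENNReal.continuous_ofReal.comp (by fun_prop)
    have := (hcont.tendsto 0).mono_left (nhdsWithin_le_nhds (s := Set.Ioi (0 : ℝ)))
    simpa using this
  exact ge_of_tendsto hlim (eventually_mem_nhdsWithin.mono fun η hη => key η hη)

/-- A null sequence of nonnegative reals is dominated by an antitone null sequence. -/
theorem exists_antitone_majorant {a : ℕ → ℝ} (ha : ∀ r, 0 ≤ a r) (h : Tendsto a atTop (𝓝 0)) :
    ∃ e : ℕ → ℝ, (∀ r, a r ≤ e r) ∧ Antitone e ∧ Tendsto e atTop (𝓝 0) := by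
  obtain ⟨b, hb⟩ := h.bddAbove_range
  have hbdd : ∀ r, BddAbove (Set.range fun s => a (r + s)) := fun r =>
    ⟨b, by rintro _ ⟨s, rfl⟩; exact hb ⟨r + s, rfl⟩⟩
  have hle : ∀ r, a r ≤ ⨆ s, a (r + s) := fun r => le_ciSup (hbdd r) 0
  refine ⟨fun r => ⨆ s, a (r + s), hle, fun r t hrt => ciSup_le fun s => ?_, ?_⟩
  · have := le_ciSup (hbdd r) (t - r + s)
    rwa [show r + (t - r + s) = t + s by omega] at this
  · rw [Metric.tendsto_atTop]
    intro ε hε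
    obtain ⟨N, hN⟩ := Metric.tendsto_atTop.1 h (ε / 2) (half_pos hε)
    refine ⟨N, fun n hn => ?_⟩
    rw [Real.dist_0_eq_abs, abs_of_nonneg ((ha n).trans (hle n))]
    refine lt_of_le_of_lt (ciSup_le fun s => ?_) (half_lt_self hε)
    have := hN (n + s) (by omega)
    rw [Real.dist_0_eq_abs] at this
    exact (le_abs_self _).trans this.le

end CesaroMeans

end Vilenkin

/-- Convergence in `L^p` (`1 ≤ p ≤ ∞`, with `L^∞ = C`) of the Cesàro means of negative order of
double Vilenkin-Fourier series on a bounded Vilenkin group. The little-o condition is expressed by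
the quotient tending to `0`; `n` and `l` tend to infinity independently of each other. -/
theorem corollary2 (m : ℕ → ℕ) [∀ k, NeZero (m k)] (hm : ∀ k, 2 ≤ m k)
    (hbdd : ∃ B : ℕ, ∀ k, m k ≤ B)
    (p : ℝ≥0∞) (hp : 1 ≤ p)
    (α β : ℝ) (hα : α ∈ Set.Ioo (0 : ℝ) 1) (hβ : β ∈ Set.Ioo (0 : ℝ) 1) (hαβ : α + β < 1)
    (f : Vilenkin.VGroup m × Vilenkin.VGroup m → ℂ) (hf : Vilenkin.MemL m p f)
    (hω : Tendsto
      (fun n : ℕ => Vilenkin.modulus m p f n / (1 / (Vilenkin.M m n : ℝ≥0∞)) ^ (α + β))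
      atTop (𝓝 0)) :
    Tendsto
      (fun q : ℕ × ℕ =>
        Vilenkin.normL m p (fun z => Vilenkin.cesaroMean m (-α) (-β) q.1 q.2 f z - f z))
      (atTop ×ˢ atTop) (𝓝 0) := by
  open Vilenkin in
  obtain ⟨B, hB⟩ := hbdd
  obtain ⟨C, hC, h⟩ := exists_normL_cesaroMean_sub_le hm hB hα hβ
  have hγ : 0 < α + β := add_pos hα.1 hβ.1
  have hM0 : ∀ r, (0 : ℝ) < M m r := fun r => by exact_mod_cast M_pos r
  set ω : ℕ → ℝ := fun r => (modulus m p f r).toReal with hωdef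
  have hωr : ∀ r, modulus m p f r = ENNReal.ofReal (ω r) := fun r =>
    (ENNReal.ofReal_toReal (modulus_lt_top hp hf r).ne).symm
  have hquot : ∀ r, modulus m p f r / (1 / (M m r : ℝ≥0∞)) ^ (α + β)
      = ENNReal.ofReal (ω r * (M m r : ℝ) ^ (α + β)) := by
    intro r
    rw [one_div, ENNReal.inv_rpow, div_eq_mul_inv, inv_inv, hωr,
      ENNReal.ofReal_mul ENNReal.toReal_nonneg, ← ENNReal.ofReal_rpow_of_pos (hM0 r),
      ENNReal.ofReal_natCast]
  have ha : Tendsto (fun r => ω r * (M m r : ℝ) ^ (α + β)) atTop (𝓝 0) := by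
    have hnn : ∀ r, 0 ≤ ω r * (M m r : ℝ) ^ (α + β) := fun r =>
      mul_nonneg ENNReal.toReal_nonneg (Real.rpow_nonneg (hM0 r).le _)
    simp only [hquot] at hω
    have := (ENNReal.tendsto_toReal ENNReal.zero_ne_top).comp hω
    refine this.congr fun r => ?_
    exact ENNReal.toReal_ofReal (hnn r)
  obtain ⟨e, hae, hanti, he0⟩ := exists_antitone_majorant
    (fun r => mul_nonneg ENNReal.toReal_nonneg (Real.rpow_nonneg (hM0 r).le _)) ha
  have he : ∀ r, 0 ≤ e r := fun r => hanti.le_of_tendsto he0 r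
  have hmod : ∀ r, modulus m p f r ≤ ENNReal.ofReal (e r / (M m r : ℝ) ^ (α + β)) := by
    intro r
    rw [hωr]
    refine ENNReal.ofReal_le_ofReal ?_
    rw [le_div_iff₀ (Real.rpow_pos_of_pos (hM0 r) _)]
    exact hae r
  have hG := tendsto_geomAverage he hanti he0
  rw [ENNReal.tendsto_nhds_zero]
  intro ε hε
  obtain ⟨δ, hδ, hδε⟩ : ∃ δ : ℝ, 0 < δ ∧ ENNReal.ofReal δ ≤ ε := by
    obtain ⟨d, hd, hdε⟩ := ENNReal.lt_iff_exists_nnreal_btwn.1 hε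
    exact ⟨d, by exact_mod_cast hd, by simpa using hdε.le⟩
  obtain ⟨k, hk⟩ :=
    (hG.eventually_le_const (show 0 < δ / (2 * C) by positivity)).exists_forall_of_atTop
  -- The block containing `n` is numbered `κ + 1`, so `n ≥ M_{k+1}` yields `κ ≥ k`. The blocks of
  -- `n` and `l` are chosen separately, which gives independent limits.
  have hblock : ∀ n, M m (k + 1) ≤ n → ∃ κ, k ≤ κ ∧ M m (κ + 1) ≤ n ∧ n < M m (κ + 2) := by
    intro n hn
    obtain ⟨j, hj, hj'⟩ := exists_M_le_lt hm ((M_pos (k + 1)).trans_le hn)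
    have hkj : k + 1 < j + 1 := (M_monotone hm).reflect_lt (hn.trans_lt hj')
    obtain ⟨κ, rfl⟩ : ∃ κ, j = κ + 1 := ⟨j - 1, by omega⟩
    exact ⟨κ, by omega, hj, hj'⟩
  filter_upwards [prod_mem_prod (Ici_mem_atTop (M m (k + 1))) (Ici_mem_atTop (M m (k + 1)))]
    with q hq
  obtain ⟨κ, hκ, hn, hn'⟩ := hblock q.1 hq.1
  obtain ⟨ν, hν, hl, hl'⟩ := hblock q.2 hq.2
  refine (h hp q.1 q.2 κ ν hn hn' hl hl' f hf e he hanti hmod).trans (le_trans ?_ hδε)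
  refine ENNReal.ofReal_le_ofReal ?_
  calc C * (geomAverage e κ + geomAverage e ν) ≤ C * (δ / (2 * C) + δ / (2 * C)) :=
        mul_le_mul_of_nonneg_left (add_le_add (hk κ hκ) (hk ν hν)) hC.le
    _ = δ := by field_simp; norm_num
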